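/- Let $\mathcal M=(\mathcal S,\mathcal A,\{p_h\}_{h\in[H]},s_1,H)$ be a finite episodic MDP with horizon $H$, fixed initial state $s_1$ and transition laws $p_h(\cdot\mid s,a)$. For a stochastic Markov policy $\pi$ let $p_h^\pi(s,a)$ and $p^\pi_h(s)$ be the probabilities that $(s_h,a_h)=(s,a)$, resp. $s_h=s$, in an episode played with $\pi$; let $\Omega=\{p^\pi:\pi\}$, $V^\pi_1(s_1;r)=\sum_{h,s,a}p^\pi_h(s,a)r_h(s,a)$ and $V_1^\star(s_1;r)=\max_\pi V_1^\pi(s_1;r)$. Assume that every state is reachable at every stage: for all $h\in\{2,\dots,H\}$ and $s\in\mathcal S$, $\max_\pi p_h^\pi(s)>0$. Let $c:[H]\times\mathcal S\times\mathcal A\to\mathbb R$ be a target function that requires no samples at stage $1$ from states other than the initial one: $c_1(s,a)\le 0$ for $s\ne s_1$. Put $\mathcal X=\{(h,s,a):c_h(s,a)>0\}$, $c_{\min}=\min_{\mathcal X}c\vee 1$, $c_{\max}=\max_{h,s,a}c_h(s,a)$, $\mathcal X_0=\mathcal X$ and $\mathcal X_k=\{(h,s,a):c_h(s,a)>c_{\min}2^k\}$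 for $k\ge1$. For a target function $f$ let $$\varphi^\star(f)=\inf_{\rho\in\Omega}\ \max_{(h,s,a):\,f_h(s,a)>0}\frac{f_h(s,a)}{\rho_h(s,a)}\in[0,\infty].$$ Let $\mathcal A^\lambda$ be an online learner on simplices: instantiated on the set $\mathcal P(\mathcal Y)$ of distributions on a nonempty set $\mathcal Y$ of triplets, it plays first the uniform distribution and then, at each step, a weight $\lambda\in\mathcal P(\mathcal Y)$ that is a function of the linear losses received since it was instantiated. Let $\mathcal A^\Pi$ be a (possibly randomized) RL algorithm that receives a confidence level and, before each episode, a reward function, and chooses the policy of the episode from it and from the past rewards and trajectories. Assume first-order regret bounds: * there is a non-decreasing $\mathcal R^\lambda:\mathbb N^*\to\mathbb R$ such that, whenever $\mathcal A^\lambda$ is instantiated on $\mathcal P(\mathcal X_k)$ with $\mathcal X_k\neq\emptyset$, for every sequence of linear losses $\ell^t$ on $\mathcal P(\mathcal X_k)$ with values in $[0,1]$ and all $T\in\mathbb N^*$, $$\sum_{t=1}^T\ell^t(\lambda^t)-\min_{\lambda\in\mathcal P(\mathcal X_k)}\sum_{t=1}^T\ell^t(\lambda)\le\sqrt{\mathcal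 R^\lambda(T)\sum_{t=1}^T\ell^t(\lambda^t)}+\mathcal R^\lambda(T);$$ * for each $\delta'\in(0,1)$ there is a non-decreasing $\mathcal R^\Pi_{\delta'}:\mathbb N^*\to\mathbb R$ such that, whenever $\mathcal A^\Pi$ is run with confidence $1-\delta'$ on rewards $\lambda^t\in\mathcal P(\mathcal X)$, each of which may be chosen as a function of the trajectories of the previous episodes, with probability at least $1-\delta'$, for all $T\in\mathbb N^*$, $$\sum_{t=1}^TV_1^\star(s_1;\lambda^t)-\sum_{t=1}^TV_1^{\pi^t}(s_1;\lambda^t)\le\sqrt{\mathcal R^\Pi_{\delta'}(T)\sum_{t=1}^TV_1^{\pi^t}(s_1;\lambda^t)}+\mathcal R^\Pi_{\delta'}(T).$$ CovGame with input $c,\mathcal A^\Pi,\mathcal A^\lambda,\delta\in(0,1)$: set $k_1=0$, instantiate $\mathcal A^\lambda$ on $\mathcal P(\mathcal X)$ and let $\lambda^1$ be uniform on $\mathcal X$. In each episode $t=1,2,\dots$: get $\pi^t$ from $\mathcal A^\Pi$ (run with confidence $1-\delta/2$) for the reward function $\lambda^t$ and play it, observing $(s^t_h,a^t_h)_{h\in[H]}$;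 let $n^t_h(s,a)=\#\{j\le t:(s^j_h,a^j_h)=(s,a)\}$. If $n^t_h(s,a)\ge c_h(s,a)$ for all $h,s,a$, stop, and let $\tau=t$. Otherwise let $k_{t+1}$ be the largest $j\in\mathbb N$ with $n_h^t(s,a)\ge c_h(s,a)$ for all $(h,s,a)\in\mathcal X\setminus\mathcal X_j$. If $k_{t+1}\ne k_t$, re-instantiate $\mathcal A^\lambda$ on $\mathcal P(\mathcal X_{k_{t+1}})$ and let $\lambda^{t+1}$ be uniform on $\mathcal X_{k_{t+1}}$; else feed $\mathcal A^\lambda$ with the loss $\ell^t(\lambda)=\sum_{(h,s,a)\in\mathcal X_{k_t}}\lambda_h(s,a)\mathbf 1\{s_h^t=s,a_h^t=a\}$ and get $\lambda^{t+1}$ from it. Let $m=\lceil\log_2(c_{\max}/c_{\min})\rceil\vee1$ and let $T_1$ be the least $T\in\mathbb N^*$ such that, for every integer $T'\ge T$, $$\frac{T'}2\ \ge\ m\,\varphi^\star(\mathbf 1_{\mathcal X})\Big(3\mathcal R^\Pi_{\delta/2}(T')+12\mathcal R^\lambda(T')+24\log(4T'/\delta)\Big)+1,$$ and assume that such a $T$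 exists. Then, with probability at least $1-\delta$, CovGame stops after a finite number $\tau$ of episodes, $n_h^\tau(s,a)\ge c_h(s,a)$ for all $h,s,a$, and $$\tau\le 64\,m\,\varphi^\star(c)+T_1.$$ -/

import Mathlib

open MeasureTheory ProbabilityTheory
open scoped ENNReal

universe u v w x

noncomputable section

namespace ActiveCoverage

/-! ### Tabular finite-horizon MDPs

Stages `1, …, H` are the elements `0, …, H - 1` of `Fin H`. -/

/-- A tabular episodic MDP with horizon `H`: an initial state and, for every stage, state and
action, the law of the next state. -/
structure MDP (H : ℕ) (S : Type v) (A : Type w) [Fintype S] where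
  init : S
  trans : Fin H → S → A → stdSimplex ℝ S

/-- Stochastic Markov policies: `π h s a` is the probability of playing `a` in `s` at stage `h`. -/
abbrev Policy (H : ℕ) (S : Type v) (A : Type w) [Fintype A] : Type (max v w) :=
  Fin H → S → stdSimplex ℝ A

/-- The triplets `(h, s, a)`. -/
abbrev Triplet (H : ℕ) (S : Type v) (A : Type w) : Type (max v w) := Fin H × S × A

/-- The trajectories `(s_h, a_h)_h` of one episode. -/
abbrev Traj (H : ℕ) (S : Type v) (A : Type w) : Type (max v w) := Fin H → S × A

variable {H : ℕ} {S : Type v} {A : Type w} [Fintype S] [Fintype A]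

open Classical in
/-- The probability of the state at stage `h` of the trajectory `y`, given what precedes it. -/
def stateFactor (M : MDP H S A) (y : Traj H S A) (h : Fin H) : ℝ :=
  if h0 : (h : ℕ) = 0 then
    if (y h).1 = M.init then 1 else 0
  else
    let g : Fin H := ⟨(h : ℕ) - 1, by omega⟩
    M.trans g (y g).1 (y g).2 (y h).1

/-- `ℙ^π(s_1 = y_1, a_1 = …, …, s_H, a_H)`: the law of one episode under `π`. -/
def trajProb (M : MDP H S A) (π : Policy H S A) (y : Traj H S A) : ℝ :=
  ∏ h : Fin H, stateFactor M y h * π h (y h).1 (y h).2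

open Classical in
/-- `p_h^π(s, a) = ℙ^π(s_h = s, a_h = a)`. -/
def visitProb (M : MDP H S A) (π : Policy H S A) (z : Triplet H S A) : ℝ :=
  ∑ y : Traj H S A with y z.1 = z.2, trajProb M π y

open Classical in
/-- `p_h^π(s) = ℙ^π(s_h = s)`. -/
def stateProb (M : MDP H S A) (π : Policy H S A) (h : Fin H) (s : S) : ℝ :=
  ∑ y : Traj H S A with (y h).1 = s, trajProb M π y

/-- The set `Ω` of the state-action distributions of stochastic policies. -/
def stateActionDists (M : MDP H S A) : Set (Triplet H S A → ℝ) :=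
  Set.range (visitProb M)

/-- Every state is reachable at every stage `h ∈ {2, …, H}`. -/
def Reachable (M : MDP H S A) : Prop :=
  ∀ h : Fin H, (h : ℕ) ≠ 0 → ∀ s : S, ∃ π : Policy H S A, 0 < stateProb M π h s

/-- `V_1^π(s_1; r) = ∑_{h,s,a} p_h^π(s, a) r_h(s, a)`. -/
def value (M : MDP H S A) (π : Policy H S A) (r : Triplet H S A → ℝ) : ℝ :=
  ∑ z, visitProb M π z * r z

/-- `V_1^⋆(s_1; r)`, the maximum of `V_1^π(s_1; r)` over all policies. -/
def optValue (M : MDP H S A) (r : Triplet H S A → ℝ) : ℝ :=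
  ⨆ π : Policy H S A, value M π r

/-! ### Target functions and the coverage complexity -/

open Classical in
/-- `𝒳 = {(h, s, a) : c_h(s, a) > 0}`. -/
def targetSet (c : Triplet H S A → ℝ) : Finset (Triplet H S A) :=
  Finset.univ.filter fun z => 0 < c z

/-- `c_min = (min_{𝒳} c) ∨ 1`. -/
def cMin (c : Triplet H S A → ℝ) : ℝ :=
  max (⨅ z : {z // z ∈ targetSet c}, c z) 1

/-- `c_max = max_{h,s,a} c_h(s, a)`. -/
def cMax (c : Triplet H S A → ℝ) : ℝ :=
  ⨆ z : Triplet H S A, c z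

open Classical in
/-- `𝒳_0 = 𝒳` and `𝒳_k = {(h, s, a) : c_h(s, a) > c_min 2^k}` for `k ≥ 1`. -/
def levelSet (c : Triplet H S A → ℝ) (k : ℕ) : Finset (Triplet H S A) :=
  if k = 0 then targetSet c else Finset.univ.filter fun z => cMin c * 2 ^ k < c z

/-- `φ⋆(c) = inf_{ρ ∈ Ω} max_{(h,s,a) ∈ 𝒳} c_h(s, a) / ρ_h(s, a)`, with value in `[0, ∞]`
(a quotient is infinite where `ρ_h(s, a) = 0`). -/
def coverageComplexity (M : MDP H S A) (c : Triplet H S A → ℝ) : ℝ≥0∞ :=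
  ⨅ ρ ∈ stateActionDists M, ⨆ z ∈ targetSet c, ENNReal.ofReal (c z) / ENNReal.ofReal (ρ z)

/-- The indicator function of `𝒳`, as a target function. -/
def targetIndicator (c : Triplet H S A → ℝ) : Triplet H S A → ℝ :=
  Set.indicator (targetSet c : Set (Triplet H S A)) fun _ => 1

/-- `m = ⌈log₂(c_max / c_min)⌉ ∨ 1`. -/
def numPhases (c : Triplet H S A → ℝ) : ℕ :=
  max ⌈Real.logb 2 (cMax c / cMin c)⌉₊ 1

/-! ### Online learning on the simplex -/

/-- `[z (t-1), …, z 0]`: the first `t` terms of a sequence. All histories below are lists whose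
most recent entry comes first. -/
def past {α : Type*} (z : ℕ → α) : ℕ → List α
  | 0 => []
  | t + 1 => z t :: past z t

/-- `q` is a probability distribution on triplets that is supported on `K`, i.e. `q ∈ 𝒫(K)`. -/
def IsDistOn (K : Finset (Triplet H S A)) (q : Triplet H S A → ℝ) : Prop :=
  q ∈ stdSimplex ℝ (Triplet H S A) ∧ ∀ z, z ∉ K → q z = 0

/-- The uniform distribution on `K`. -/
def uniformOn (K : Finset (Triplet H S A)) : Triplet H S A → ℝ :=
  Set.indicator (K : Set (Triplet H S A)) fun _ => (K.card : ℝ)⁻¹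

variable (H S A) in
/-- An online learner for linear losses on the simplices `𝒫(K)`: it maps the domain `K` and the
loss vectors received since it was instantiated on `𝒫(K)` to the next weight vector. -/
structure OnlineLearner where
  weight : Finset (Triplet H S A) → List (Triplet H S A → ℝ) → Triplet H S A → ℝ
  weight_mem : ∀ K, K.Nonempty → ∀ ls, IsDistOn K (weight K ls)

/-- The weights that are played after the losses `ls`: uniform at instantiation, and then chosen
by the learner. -/
def OnlineLearner.play (L : OnlineLearner H S A) (K : Finset (Triplet H S A)) :
    List (Triplet H S A → ℝ) → Triplet H S A → ℝ
  | [] => uniformOn K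
  | l :: ls => L.weight K (l :: ls)

/-- The linear loss `q ↦ ∑_{z ∈ K} q(z) l(z)`. -/
def linLoss (K : Finset (Triplet H S A)) (l q : Triplet H S A → ℝ) : ℝ :=
  ∑ z ∈ K, q z * l z

/-- First-order regret of the online learner, with regret function `R`, on every (nonempty)
`𝒳_k`: it holds against every comparator in `𝒫(𝒳_k)`, for every sequence of linear losses
on `𝒫(𝒳_k)` with values in `[0, 1]`. -/
def OnlineFirstOrderRegret (c : Triplet H S A → ℝ) (L : OnlineLearner H S A) (R : ℕ → ℝ) :
    Prop :=
  MonotoneOn R (Set.Ici 1) ∧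
  ∀ k, (levelSet c k).Nonempty →
    ∀ l : ℕ → Triplet H S A → ℝ,
      (∀ t z, 0 ≤ l t z ∧ l t z ≤ 1) → (∀ t z, z ∉ levelSet c k → l t z = 0) →
    ∀ T : ℕ, 1 ≤ T → ∀ q : Triplet H S A → ℝ, IsDistOn (levelSet c k) q →
      (∑ t ∈ Finset.range T, linLoss (levelSet c k) (l t) (L.play (levelSet c k) (past l t)))
          - ∑ t ∈ Finset.range T, linLoss (levelSet c k) (l t) q
        ≤ √(R T * ∑ t ∈ Finset.range T,
              linLoss (levelSet c k) (l t) (L.play (levelSet c k) (past l t))) + R T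

/-! ### Reinforcement learning with changing rewards -/

variable (H S A) in
/-- A (possibly randomized) RL algorithm for rewards that change at every episode and are revealed
before the episode: from the failure probability `δ` (its confidence is `1 - δ`), its internal
random seed, the rewards and trajectories of the past episodes and the current reward, it computes
the policy of the current episode. -/
structure RLLearner (Ξ : Type x) [MeasurableSpace Ξ] where
  seedLaw : Measure Ξ
  isProb : IsProbabilityMeasure seedLaw
  act : ℝ → Ξ → List ((Triplet H S A → ℝ) × Traj H S A) → (Triplet H S A → ℝ) → Policy H S A
  act_meas : ∀ δ hist r h s a, Measurable fun ξ => (act δ ξ hist r h s a : ℝ)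

/-- The history that the RL learner sees when the rewards follow the rule `rew`, which maps the
past trajectories to the reward of the current episode. -/
def feedback (rew : List (Traj H S A) → Triplet H S A → ℝ) :
    List (Traj H S A) → List ((Triplet H S A → ℝ) × Traj H S A)
  | [] => []
  | y :: hist => (rew hist, y) :: feedback rew hist

section Runs

variable {Ξ : Type x} [MeasurableSpace Ξ] {Ω : Type u}

/-- The reward of episode `t` (episodes are numbered from `0`). -/
def rewardAt (rew : List (Traj H S A) → Triplet H S A → ℝ) (Y : ℕ → Ω → Traj H S A)
    (t : ℕ) (ω : Ω) : Triplet H S A → ℝ :=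
  rew (past (fun j => Y j ω) t)

/-- The policy that the RL learner plays in episode `t`. -/
def policyAt (P : RLLearner H S A Ξ) (δ : ℝ) (rew : List (Traj H S A) → Triplet H S A → ℝ)
    (ξ : Ω → Ξ) (Y : ℕ → Ω → Traj H S A) (t : ℕ) (ω : Ω) : Policy H S A :=
  P.act δ (ξ ω) (feedback rew (past (fun j => Y j ω) t)) (rewardAt rew Y t ω)

/-- `Y 0, Y 1, …` are the successive trajectories of the RL learner `P`, run with confidence
`1 - δ` and seed `ξ` on the MDP `M` with rewards given by `rew`: the seed has its prescribed law
and, given the past `ℱ t`, the trajectory `Y t` has the law of one episode under the policy of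
episode `t`. -/
structure IsRun (M : MDP H S A) (P : RLLearner H S A Ξ) (δ : ℝ)
    (rew : List (Traj H S A) → Triplet H S A → ℝ)
    [mΩ : MeasurableSpace Ω] (μ : Measure Ω) (ℱ : Filtration ℕ mΩ)
    (ξ : Ω → Ξ) (Y : ℕ → Ω → Traj H S A) : Prop where
  seed_meas : Measurable[ℱ 0] ξ
  seed_law : μ.map ξ = P.seedLaw
  traj_meas : ∀ t y, MeasurableSet[ℱ (t + 1)] {ω | Y t ω = y}
  traj_law : ∀ t y,
    μ[Set.indicator {ω | Y t ω = y} (fun _ => (1 : ℝ)) | ℱ t]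
      =ᵐ[μ] fun ω => trajProb M (policyAt P δ rew ξ Y t ω) y

end Runs

/-- First-order regret of the RL learner, with regret functions `R δ`: for every `δ ∈ (0, 1)`
and every way of choosing rewards in `𝒫(𝒳)`, each from the trajectories observed before, the
bound holds for all `T ≥ 1` simultaneously with probability at least `1 - δ`. -/
def RLFirstOrderRegret {Ξ : Type x} [MeasurableSpace Ξ] (M : MDP H S A)
    (c : Triplet H S A → ℝ) (P : RLLearner H S A Ξ) (R : ℝ → ℕ → ℝ) : Prop :=
  ∀ δ : ℝ, 0 < δ → δ < 1 →
    MonotoneOn (R δ) (Set.Ici 1) ∧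
    ∀ rew : List (Traj H S A) → Triplet H S A → ℝ,
      (∀ hist, IsDistOn (targetSet c) (rew hist)) →
    ∀ (Ω : Type u) [mΩ : MeasurableSpace Ω] (μ : Measure Ω) [IsProbabilityMeasure μ]
      (ℱ : Filtration ℕ mΩ) (ξ : Ω → Ξ) (Y : ℕ → Ω → Traj H S A),
      IsRun M P δ rew μ ℱ ξ Y →
      ENNReal.ofReal (1 - δ) ≤ μ {ω | ∀ T : ℕ, 1 ≤ T →
        (∑ t ∈ Finset.range T, optValue M (rewardAt rew Y t ω))
            - ∑ t ∈ Finset.range T, value M (policyAt P δ rew ξ Y t ω) (rewardAt rew Y t ω)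
          ≤ √(R δ T * ∑ t ∈ Finset.range T,
                value M (policyAt P δ rew ξ Y t ω) (rewardAt rew Y t ω)) + R δ T}

/-! ### CovGame -/

open Classical in
/-- `n_h(s, a)`: how many of the trajectories in `hist` visit `(s, a)` at stage `h`. -/
def visitCount (hist : List (Traj H S A)) (z : Triplet H S A) : ℕ :=
  hist.countP fun y => y z.1 = z.2

/-- `max {j : n_h(s, a) ≥ c_h(s, a) for all (h, s, a) ∈ 𝒳 ∖ 𝒳_j}`. The maximum exists as long as
some requirement is not met; once all are met the algorithm has stopped, and the value (`0`) only
serves to define a fictitious continuation. -/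
def newLevel (c : Triplet H S A → ℝ) (hist : List (Traj H S A)) : ℕ :=
  sSup {j : ℕ | ∀ z ∈ targetSet c, z ∉ levelSet c j → c z ≤ visitCount hist z}

open Classical in
/-- The loss vector `(h, s, a) ↦ 𝟙(s_h = s, a_h = a)` of the trajectory `y`, restricted to `K`. -/
def lossVec (K : Finset (Triplet H S A)) (y : Traj H S A) (z : Triplet H S A) : ℝ :=
  if z ∈ K ∧ y z.1 = z.2 then 1 else 0

/-- After the trajectories `hist`: the current level `k`, and the losses that were fed to the
online learner since its last reset. -/
def covGameState (c : Triplet H S A → ℝ) :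
    List (Traj H S A) → ℕ × List (Triplet H S A → ℝ)
  | [] => (0, [])
  | y :: hist =>
    let k := (covGameState c hist).1
    let k' := newLevel c (y :: hist)
    if k' ≠ k then (k', [])
    else (k, lossVec (levelSet c k) y :: (covGameState c hist).2)

/-- The weights `λ` of CovGame after the trajectories `hist`, which are the reward function of the
next episode. -/
def covGameReward (c : Triplet H S A → ℝ) (L : OnlineLearner H S A)
    (hist : List (Traj H S A)) : Triplet H S A → ℝ :=
  L.play (levelSet c (covGameState c hist).1) (covGameState c hist).2

/-- CovGame, observing the trajectories `y 0, y 1, …`, stops after exactly `τ` episodes: `τ ≥ 1`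
is the first number of episodes after which all sampling requirements are met. -/
def StopsAfter (c : Triplet H S A → ℝ) (y : ℕ → Traj H S A) (τ : ℕ) : Prop :=
  IsLeast {t : ℕ | 1 ≤ t ∧ ∀ z, c z ≤ visitCount (past y t) z} τ

/-- The lower-order term `T_1 ∈ [1, ∞]`: the least `T ≥ 1` from which on
`T / 2 ≥ m φ⋆(𝟙_𝒳) (3 R^Π(T) + 12 R^λ(T) + 24 log(4 T / δ)) + 1`, and `∞` if there is none. -/
def lowerOrderTerm (M : MDP H S A) (c : Triplet H S A → ℝ) (δ : ℝ) (RPi Rlam : ℕ → ℝ) : ℝ≥0∞ :=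
  ⨅ T ∈ {T : ℕ | 1 ≤ T ∧ ∀ T' : ℕ, T ≤ T' →
      (numPhases c : ℝ≥0∞) * coverageComplexity M (targetIndicator c)
          * ENNReal.ofReal (3 * RPi T' + 12 * Rlam T' + 24 * Real.log (4 * T' / δ)) + 1
        ≤ (T' : ℝ≥0∞) / 2},
    (T : ℝ≥0∞)

end ActiveCoverage

end

noncomputable section

namespace ActiveCoverage

/-! Write Φ_k for φ⋆ of the indicator of 𝒳_k; since the 𝒳_k are nested, Φ_k is non-increasing. As
long as some requirement is unmet, the level of CovGame never decreases and stays below m, so the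
first T episodes split into m consecutive, possibly empty, phases. Weak duality
(`one_le_coverageComplexity_mul_optValue`) says that every reward in 𝒫(𝒳_k) has optimal value at
least 1 / Φ_k. Hence T ≤ ∑_j Φ_j · (sum of the optimal values in phase j), and it is enough to bound
optimal values from above.

Three inequalities do this. The first-order RL regret and AM-GM bound a sum of optimal values by 3/2
of the sum of the played values plus 3/2 of the regret function. An exponential supermartingale
(`measure_sum_deviation_le`) bounds the played values by twice the weight collected on the observed
trajectories, plus a logarithm. In phase j, the online learner collects little weight, because some
triplet z with c z ≤ c_min 2^(j+1) is still undersampled: comparison with the point mass at z gives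
at most 2 (c z + 1) plus three times the regret function (`sum_visitedMass_phase_le`).

The RL regret and the deviation bound only concern sums that start at the first episode, so phases
cannot be treated one by one. Since Φ is non-increasing, Abel summation
(`sum_mul_le_of_prefix_sum_le`) turns the bounds on prefixes into a bound on the Φ-weighted sum.
With Φ_j (c z + 1) ≤ 2 φ⋆(c) + 3 φ⋆(𝟙_𝒳) (`coverageComplexity_level_mul_le`), this bounds T by 12 m
φ⋆(c) plus terms in φ⋆(𝟙_𝒳), which are at most T / 2 - 1 once T ≥ T₁. The integer part of 64 m φ⋆(c)
+ T₁ violates this bound, so all requirements are met by then. -/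

/-! ### Abel summation, phases, and an elementary exponential inequality. -/

/-- If the partial sums of `d` are dominated by those of `g`, the same holds for the sums weighted
by a nonnegative non-increasing sequence. -/
lemma sum_mul_le_of_prefix_sum_le {f d g : ℕ → ℝ} (hf : Antitone f) (hf0 : ∀ j, 0 ≤ f j) (m : ℕ)
    (h : ∀ j ≤ m, ∑ i ∈ Finset.range j, d i ≤ ∑ i ∈ Finset.range j, g i) :
    ∑ i ∈ Finset.range m, f i * d i ≤ ∑ i ∈ Finset.range m, f i * g i := by
  -- The induction carries the slack of the prefix inequality, weighted by the current `f n`;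
  -- passing to the smaller `f (n + 1)` only decreases this term.
  have key : ∀ n ≤ m, f n * (∑ i ∈ Finset.range n, g i - ∑ i ∈ Finset.range n, d i)
      ≤ ∑ i ∈ Finset.range n, f i * g i - ∑ i ∈ Finset.range n, f i * d i := by
    intro n
    induction n with
    | zero => simp
    | succ n ih =>
      intro hn
      have h1 := ih (by omega)
      have h2 := h (n + 1) hn
      have h3 := hf (Nat.le_succ n)
      simp only [Finset.sum_range_succ] at h2 ⊢
      have h4 := mul_le_mul_of_nonneg_right h3 (sub_nonneg.2 h2)
      rw [Nat.succ_eq_add_one] at h4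
      linarith
  have h1 := key m le_rfl
  have h2 := mul_nonneg (hf0 m) (sub_nonneg.2 (h m le_rfl))
  linarith

/-- The witness is the first time before `T` at which `k` reaches `j`, or `T` itself if there is
none. These times delimit the phases. -/
lemma exists_threshold {k : ℕ → ℕ} {T : ℕ} (hk : ∀ s t, s ≤ t → t ≤ T → k s ≤ k t) (j : ℕ) :
    ∃ n ≤ T, ∀ t < T, t < n ↔ k t < j := by
  classical
  by_cases h : ∃ t, t < T ∧ j ≤ k t
  · obtain ⟨h1, h2⟩ := Nat.find_spec h
    refine ⟨Nat.find h, h1.le, fun t ht => ⟨fun h3 => ?_, fun h3 => ?_⟩⟩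
    · have := Nat.find_min h h3
      simp only [not_and, not_le] at this
      exact this ht
    · by_contra h4
      have := hk _ _ (not_lt.1 h4) ht.le
      omega
  · push Not at h
    exact ⟨T, le_rfl, fun t ht => ⟨fun _ => h t ht, fun _ => ht⟩⟩

lemma sum_range_eq_sum_phases {M : Type*} [AddCommMonoid M] (θ : ℕ → ℕ) (hθ : Monotone θ)
    (h0 : θ 0 = 0) (g : ℕ → M) (j : ℕ) :
    ∑ t ∈ Finset.range (θ j), g t
      = ∑ i ∈ Finset.range j, ∑ t ∈ Finset.Ico (θ i) (θ (i + 1)), g t := by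
  induction j with
  | zero => simp [h0]
  | succ j ih =>
    rw [Finset.sum_range_succ, ← ih, Finset.range_eq_Ico, Finset.range_eq_Ico,
      Finset.sum_Ico_consecutive _ (Nat.zero_le _) (hθ (Nat.le_succ j))]

lemma exp_neg_le_one_sub_half {x : ℝ} (h0 : 0 ≤ x) (h1 : x ≤ 1) :
    Real.exp (-x) ≤ 1 - x / 2 := by
  have h := Real.add_one_le_exp x
  rw [Real.exp_neg, inv_le_comm₀ (Real.exp_pos _) (by linarith)]
  refine le_trans ?_ h
  rw [inv_le_iff_one_le_mul₀ (by linarith)]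
  nlinarith

/-! ### Multiplicative lower deviations by an exponential supermartingale. -/

section Concentration

variable {Ω : Type u} {ι : Type*} [Fintype ι] {m : MeasurableSpace Ω} [mΩ : MeasurableSpace Ω] {μ : Measure Ω}
  [IsProbabilityMeasure μ]

lemma integral_indicator_mul_eq (hm : m ≤ mΩ) {s : Set Ω}
    (hs : MeasurableSet s) {p W : Ω → ℝ}
    (hp : μ[s.indicator (fun _ => (1 : ℝ)) | m] =ᵐ[μ] p)
    (hW : Measurable[m] W) {C : ℝ} (hC : ∀ ω, |W ω| ≤ C) :
    ∫ ω, W ω * s.indicator (fun _ => (1 : ℝ)) ω ∂μ = ∫ ω, W ω * p ω ∂μ := by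
  have hi : Integrable (s.indicator (fun _ => (1 : ℝ))) μ :=
    (integrable_const (1 : ℝ)).indicator hs
  have hWi : Integrable (W * s.indicator (fun _ => (1 : ℝ))) μ :=
    hi.bdd_mul (c := C) (hW.mono hm le_rfl).aestronglyMeasurable (Filter.Eventually.of_forall hC)
  have h := condExp_mul_of_stronglyMeasurable_left (m := m) hW.stronglyMeasurable hWi hi
  calc ∫ ω, W ω * s.indicator (fun _ => (1 : ℝ)) ω ∂μ
      = ∫ ω, (μ[W * s.indicator (fun _ => (1 : ℝ)) | m]) ω ∂μ := (integral_condExp hm).symm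
    _ = _ := integral_congr_ae (by filter_upwards [h, hp] with ω h1 h2; simp [h1, h2])

-- Given `m`, the factor exp(-x) has mean at most 1 - V/2 ≤ exp(-V/2), where V is the conditional
-- mean of x; the factor exp(V/2) compensates exactly. This is one step of the supermartingale.
open Classical in
lemma integral_exp_step_le (hm : m ≤ mΩ) {Y : Ω → ι} {p x : ι → Ω → ℝ}
    (hY : ∀ y, MeasurableSet {ω | Y ω = y})
    (hpm : ∀ y, Measurable[m] (p y)) (hp : ∀ y ω, 0 ≤ p y ω ∧ p y ω ≤ 1)
    (hxm : ∀ y, Measurable[m] (x y)) (hx : ∀ y ω, 0 ≤ x y ω ∧ x y ω ≤ 1)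
    (hlaw : ∀ y, μ[Set.indicator {ω | Y ω = y} (fun _ => (1 : ℝ)) | m] =ᵐ[μ] p y)
    {Z : Ω → ℝ} (hZm : Measurable[m] Z) {C : ℝ} (hZC : ∀ ω, |Z ω| ≤ C) :
    ∫ ω, Real.exp (Z ω + ((∑ y, p y ω * x y ω) / 2 - x (Y ω) ω)) ∂μ
      ≤ ∫ ω, Real.exp (Z ω) ∂μ := by
  set V : Ω → ℝ := fun ω => ∑ y, p y ω * x y ω with hV
  have hVm : Measurable[m] V := Finset.measurable_sum _ fun y _ => (hpm y).mul (hxm y)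
  have hV0 : ∀ ω, 0 ≤ V ω := fun ω =>
    Finset.sum_nonneg fun y _ => mul_nonneg (hp y ω).1 (hx y ω).1
  have hVc : ∀ ω, V ω ≤ Fintype.card ι := fun ω => by
    calc V ω ≤ ∑ _y : ι, (1 : ℝ) :=
          Finset.sum_le_sum fun y _ => mul_le_one₀ (hp y ω).2 (hx y ω).1 (hx y ω).2
      _ = _ := by simp
  set W : Ω → ℝ := fun ω => Real.exp (Z ω + V ω / 2) with hW
  have hWm : Measurable[m] W := (hZm.add (hVm.div_const 2)).exp
  set D : ℝ := Real.exp (C + Fintype.card ι) with hD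
  have hW0 : ∀ ω, 0 ≤ W ω := fun ω => (Real.exp_pos _).le
  have hWD : ∀ ω, W ω ≤ D := fun ω => Real.exp_le_exp.2 (by
    have := (abs_le.1 (hZC ω)).2
    linarith [hVc ω, hV0 ω])
  have hbdd : ∀ {g : Ω → ℝ} (E : ℝ), Measurable g → (∀ ω, |g ω| ≤ E) → Integrable g μ :=
    fun E h1 h2 => Integrable.of_bound h1.aestronglyMeasurable E (Filter.Eventually.of_forall h2)
  have hind : ∀ y, Measurable (Set.indicator {ω | Y ω = y} (fun _ => (1 : ℝ))) :=
    fun y => measurable_const.indicator (hY y)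
  have hind1 : ∀ y ω, |Set.indicator {ω | Y ω = y} (fun _ => (1 : ℝ)) ω| ≤ 1 := by
    intro y ω
    by_cases h : Y ω = y <;> simp [Set.indicator, h]
  have hsum : ∀ (F : ι → Ω → ℝ) ω,
      ∑ y, F y ω * Set.indicator {ω | Y ω = y} (fun _ => (1 : ℝ)) ω = F (Y ω) ω := by
    intro F ω
    simp [Set.indicator]
  have hWle : ∀ {a : ℝ} ω, 0 ≤ a → a ≤ 1 → |W ω * a| ≤ D := fun {a} ω h0 h1 => by
    rw [abs_of_nonneg (mul_nonneg (hW0 ω) h0)]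
    exact (mul_le_of_le_one_right (hW0 ω) h1).trans (hWD ω)
  have hFm : ∀ y, Measurable[m] fun ω => W ω * Real.exp (-x y ω) :=
    fun y => hWm.mul (hxm y).neg.exp
  have hFb : ∀ y ω, |W ω * Real.exp (-x y ω)| ≤ D := fun y ω =>
    hWle ω (Real.exp_pos _).le (Real.exp_le_one_iff.2 (by linarith [(hx y ω).1]))
  have hpint : ∀ {G : ι → Ω → ℝ} (_ : ∀ y, Measurable[m] (G y)) (_ : ∀ y ω, |G y ω| ≤ D),
      ∫ ω, G (Y ω) ω ∂μ = ∑ y, ∫ ω, G y ω * p y ω ∂μ := by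
    intro G hG hGb
    rw [← Finset.sum_congr rfl fun y _ =>
      integral_indicator_mul_eq hm (hY y) (hlaw y) (hG y) (hGb y)]
    rw [← integral_finsetSum]
    · exact integral_congr_ae (Filter.Eventually.of_forall fun ω => (hsum G ω).symm)
    · refine fun y _ => hbdd (D * 1) (((hG y).mono hm le_rfl).mul (hind y)) fun ω => ?_
      rw [abs_mul]
      exact mul_le_mul (hGb y ω) (hind1 y ω) (abs_nonneg _) ((abs_nonneg _).trans (hGb y ω))
  have hi : ∀ {G : ι → Ω → ℝ} (_ : ∀ y, Measurable[m] (G y)) (_ : ∀ y ω, |G y ω| ≤ D) y,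
      Integrable (fun ω => G y ω * p y ω) μ := by
    intro G hG hGb y
    refine hbdd (D * 1) ((hG y).mono hm le_rfl |>.mul ((hpm y).mono hm le_rfl)) fun ω => ?_
    rw [abs_mul, abs_of_nonneg (hp y ω).1]
    exact mul_le_mul (hGb y ω) (hp y ω).2 (hp y ω).1 ((abs_nonneg _).trans (hGb y ω))
  have hWb : ∀ ω, |W ω| ≤ D := fun ω => by simpa using hWle (a := 1) ω zero_le_one le_rfl
  have hWxm : ∀ y, Measurable[m] fun ω => W ω * x y ω := fun y => hWm.mul (hxm y)
  have hWxb : ∀ y ω, |W ω * x y ω| ≤ D := fun y ω => hWle ω (hx y ω).1 (hx y ω).2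
  have hWVi : Integrable (fun ω => W ω * V ω) μ := by
    refine hbdd (D * Fintype.card ι) ((hWm.mul hVm).mono hm le_rfl) fun ω => ?_
    rw [abs_of_nonneg (mul_nonneg (hW0 ω) (hV0 ω))]
    exact mul_le_mul (hWD ω) (hVc ω) (hV0 ω) ((hW0 ω).trans (hWD ω))
  calc ∫ ω, Real.exp (Z ω + (V ω / 2 - x (Y ω) ω)) ∂μ
      = ∫ ω, (fun y ω => W ω * Real.exp (-x y ω)) (Y ω) ω ∂μ := by
        congr 1; ext ω
        simp only [hW]
        rw [← Real.exp_add]; congr 1; ring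
    _ = ∑ y, ∫ ω, W ω * Real.exp (-x y ω) * p y ω ∂μ := hpint hFm hFb
    _ ≤ ∑ y, ∫ ω, (W ω * p y ω - W ω * x y ω * p y ω * (1 / 2)) ∂μ := by
        refine Finset.sum_le_sum fun y _ => integral_mono (hi hFm hFb y)
          ((hi (G := fun _ => W) (fun _ => hWm) (fun _ => hWb) y).sub
            ((hi hWxm hWxb y).mul_const _)) fun ω => ?_
        have := mul_le_mul_of_nonneg_left (exp_neg_le_one_sub_half (hx y ω).1 (hx y ω).2)
          (mul_nonneg (hW0 ω) (hp y ω).1)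
        simp only
        linarith
    _ = ∑ y, ∫ ω, W ω * p y ω ∂μ - ∫ ω, W ω * V ω * (1 / 2) ∂μ := by
        have h1 : ∫ ω, W ω * V ω * (1 / 2) ∂μ = ∑ y, ∫ ω, W ω * x y ω * p y ω * (1 / 2) ∂μ := by
          rw [← integral_finsetSum _ fun y _ => (hi hWxm hWxb y).mul_const _]
          congr 1; ext ω
          simp only [hV, Finset.mul_sum, Finset.sum_mul]
          exact Finset.sum_congr rfl fun y _ => by ring
        rw [h1, ← Finset.sum_sub_distrib]
        exact Finset.sum_congr rfl fun y _ =>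
          integral_sub (hi (G := fun _ => W) (fun _ => hWm) (fun _ => hWb) y)
            ((hi hWxm hWxb y).mul_const _)
    -- Applying `hpint` to a function that does not depend on `y` replaces a separate proof that the
    -- `p y` sum to one.
    _ = ∫ ω, W ω ∂μ - ∫ ω, W ω * V ω * (1 / 2) ∂μ := by
        rw [← hpint (G := fun _ => W) (fun _ => hWm) (fun _ => hWb)]
    _ = ∫ ω, (W ω - W ω * V ω * (1 / 2)) ∂μ := by
        exact (integral_sub (hbdd D (hWm.mono hm le_rfl) hWb) (hWVi.mul_const _)).symm
    _ ≤ ∫ ω, Real.exp (Z ω) ∂μ := by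
        have hle : ∀ ω, W ω - W ω * V ω * (1 / 2) ≤ Real.exp (Z ω) := fun ω => by
          have h1 : W ω * Real.exp (-(V ω / 2)) = Real.exp (Z ω) := by
            simp only [hW]
            rw [← Real.exp_add]; congr 1; ring
          have h2 := mul_le_mul_of_nonneg_left (Real.add_one_le_exp (-(V ω / 2))) (hW0 ω)
          linarith
        refine integral_mono ((hbdd D (hWm.mono hm le_rfl) hWb).sub (hWVi.mul_const _))
          (hbdd (Real.exp C) (hZm.exp.mono hm le_rfl) fun ω => ?_) hle
        rw [abs_of_pos (Real.exp_pos _)]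
        exact Real.exp_le_exp.2 ((le_abs_self _).trans (hZC ω))

/-- Lower deviations of the observed values `x t (Y t)` from their conditional means, uniformly
over the first `T` steps. -/
lemma measure_sum_deviation_le (ℱ : Filtration ℕ mΩ) {Y : ℕ → Ω → ι} {p x : ℕ → ι → Ω → ℝ}
    (hY : ∀ t y, MeasurableSet[ℱ (t + 1)] {ω | Y t ω = y})
    (hpm : ∀ t y, Measurable[ℱ t] (p t y)) (hp : ∀ t y ω, 0 ≤ p t y ω ∧ p t y ω ≤ 1)
    (hxm : ∀ t y, Measurable[ℱ t] (x t y)) (hx : ∀ t y ω, 0 ≤ x t y ω ∧ x t y ω ≤ 1)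
    (hlaw : ∀ t y, μ[Set.indicator {ω | Y t ω = y} (fun _ => (1 : ℝ)) | ℱ t] =ᵐ[μ] p t y)
    {T : ℕ} {ε : ℝ} (hT : 1 ≤ T) (hε : 0 < ε) :
    μ {ω | ∀ t, 1 ≤ t → t ≤ T → ∑ s ∈ Finset.range t, ∑ y, p s y ω * x s y ω
        ≤ 2 * ∑ s ∈ Finset.range t, x s (Y s ω) ω + 2 * Real.log (T / ε)}ᶜ
      ≤ ENNReal.ofReal ε := by
  classical
  set V : ℕ → Ω → ℝ := fun s ω => ∑ y, p s y ω * x s y ω with hV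
  set Z : ℕ → Ω → ℝ := fun t ω => ∑ s ∈ Finset.range t, (V s ω / 2 - x s (Y s ω) ω) with hZ
  have hxY : ∀ s, Measurable[ℱ (s + 1)] fun ω => x s (Y s ω) ω := by
    intro s
    have h1 : (fun ω => x s (Y s ω) ω)
        = fun ω => ∑ y, Set.indicator {ω | Y s ω = y} (x s y) ω := by
      ext ω; simp [Set.indicator]
    rw [h1]
    exact Finset.measurable_sum _ fun y _ =>
      Measurable.indicator ((hxm s y).mono (ℱ.mono (Nat.le_succ s)) le_rfl) (hY s y)
  have hVm : ∀ s, Measurable[ℱ s] (V s) := fun s =>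
    Finset.measurable_sum _ fun y _ => (hpm s y).mul (hxm s y)
  have hVb : ∀ s ω, 0 ≤ V s ω ∧ V s ω ≤ Fintype.card ι := fun s ω =>
    ⟨Finset.sum_nonneg fun y _ => mul_nonneg (hp s y ω).1 (hx s y ω).1, by
      calc V s ω ≤ ∑ _y : ι, (1 : ℝ) := Finset.sum_le_sum fun y _ =>
            mul_le_one₀ (hp s y ω).2 (hx s y ω).1 (hx s y ω).2
        _ = _ := by simp⟩
  have hZm : ∀ t, Measurable[ℱ t] (Z t) := fun t =>
    Finset.measurable_sum _ fun s hs => by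
      have hs' := Finset.mem_range.1 hs
      exact (((hVm s).mono (ℱ.mono hs'.le) le_rfl).div_const 2).sub
        ((hxY s).mono (ℱ.mono hs') le_rfl)
  have hZb : ∀ t ω, |Z t ω| ≤ t * (Fintype.card ι + 1) := fun t ω => by
    calc |Z t ω| ≤ ∑ s ∈ Finset.range t, |V s ω / 2 - x s (Y s ω) ω| :=
          Finset.abs_sum_le_sum_abs _ _
      _ ≤ ∑ _s ∈ Finset.range t, ((Fintype.card ι : ℝ) + 1) := Finset.sum_le_sum fun s _ => by
          have h1 := hVb s ω
          have h2 := hx s (Y s ω) ω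
          rw [abs_le]; constructor <;> linarith
      _ = _ := by rw [Finset.sum_const, Finset.card_range, nsmul_eq_mul]
  have hint : ∀ t, ∫ ω, Real.exp (Z t ω) ∂μ ≤ 1 := by
    intro t
    induction t with
    | zero => simp [hZ]
    | succ t ih =>
      refine le_trans (le_of_eq ?_) ((integral_exp_step_le (ℱ.le t)
        (fun y => ℱ.le (t + 1) _ (hY t y)) (hpm t) (hp t) (hxm t) (hx t) (hlaw t) (hZm t)
        (hZb t)).trans ih)
      simp only [hZ, Finset.sum_range_succ, hV]
  have hTε : (0 : ℝ) < T / ε := div_pos (by exact_mod_cast hT) hε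
  -- The threshold `T / ε` costs `ε / T` at each time, hence `ε` in the union over `T` times.
  have hmarkov : ∀ t, μ {ω | (T : ℝ) / ε ≤ Real.exp (Z t ω)} ≤ ENNReal.ofReal (ε / T) := by
    intro t
    have hi : Integrable (fun ω => Real.exp (Z t ω)) μ :=
      Integrable.of_bound ((hZm t).mono (ℱ.le t) le_rfl).exp.aestronglyMeasurable
        (Real.exp (t * (Fintype.card ι + 1))) (Filter.Eventually.of_forall fun ω => by
          rw [Real.norm_eq_abs, abs_of_pos (Real.exp_pos _)]
          exact Real.exp_le_exp.2 ((le_abs_self _).trans (hZb t ω)))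
    have h1 := (mul_meas_ge_le_integral_of_nonneg
      (Filter.Eventually.of_forall fun ω => (Real.exp_pos (Z t ω)).le) hi (T / ε)).trans (hint t)
    rw [← ofReal_measureReal]
    refine ENNReal.ofReal_le_ofReal ?_
    rw [div_mul_eq_mul_div, div_le_one hε] at h1
    rw [le_div_iff₀ (by exact_mod_cast hT)]
    linarith
  calc _ ≤ μ (⋃ t ∈ Finset.Icc 1 T, {ω | (T : ℝ) / ε ≤ Real.exp (Z t ω)}) := by
        refine measure_mono fun ω hω => ?_
        simp only [Set.mem_compl_iff, Set.mem_ofPred_eq, not_forall, not_le] at hω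
        obtain ⟨t, ht1, htT, h⟩ := hω
        simp only [Set.mem_iUnion, Finset.mem_Icc, Set.mem_ofPred_eq]
        refine ⟨t, ⟨ht1, htT⟩, ?_⟩
        rw [← Real.log_le_iff_le_exp hTε]
        simp only [hZ, Finset.sum_sub_distrib, ← Finset.sum_div]
        linarith
    _ ≤ ∑ t ∈ Finset.Icc 1 T, μ {ω | (T : ℝ) / ε ≤ Real.exp (Z t ω)} :=
        measure_biUnion_finset_le _ _
    _ ≤ ∑ _t ∈ Finset.Icc 1 T, ENNReal.ofReal (ε / T) := Finset.sum_le_sum fun t _ => hmarkov t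
    _ = ENNReal.ofReal ε := by
        have hT0 : (T : ℝ) ≠ 0 := by positivity
        rw [Finset.sum_const, Nat.card_Icc, nsmul_eq_mul, Nat.add_sub_cancel,
          ← ENNReal.ofReal_natCast, ← ENNReal.ofReal_mul (by positivity), mul_div_cancel₀ _ hT0]

end Concentration

variable {H : ℕ} {S : Type v} {A : Type w} [Fintype S] [Fintype A]

/-! ### Trajectory laws and values -/

lemma stateFactor_mem (M : MDP H S A) (y : Traj H S A) (h : Fin H) :
    0 ≤ stateFactor M y h ∧ stateFactor M y h ≤ 1 := by
  unfold stateFactor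
  split_ifs <;> simp only [zero_le_one, le_refl, and_self]
  exact mem_Icc_of_mem_stdSimplex (M.trans _ _ _).2 _

lemma trajProb_mem (M : MDP H S A) (π : Policy H S A) (y : Traj H S A) :
    0 ≤ trajProb M π y ∧ trajProb M π y ≤ 1 := by
  have h : ∀ h : Fin H, 0 ≤ stateFactor M y h * π h (y h).1 (y h).2 ∧
      stateFactor M y h * π h (y h).1 (y h).2 ≤ 1 := fun h => by
    have h1 := stateFactor_mem M y h
    have h2 : (π h (y h).1 (y h).2 : ℝ) ∈ Set.Icc (0 : ℝ) 1 :=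
      mem_Icc_of_mem_stdSimplex (π h (y h).1).2 _
    exact ⟨mul_nonneg h1.1 h2.1, mul_le_one₀ h1.2 h2.1 h2.2⟩
  exact ⟨Finset.prod_nonneg fun i _ => (h i).1,
    Finset.prod_le_one (fun i _ => (h i).1) fun i _ => (h i).2⟩

lemma visitProb_nonneg (M : MDP H S A) (π : Policy H S A) (z : Triplet H S A) :
    0 ≤ visitProb M π z :=
  Finset.sum_nonneg fun y _ => (trajProb_mem M π y).1

open Classical in
/-- The total weight under `q` of the triplets that the trajectory `y` visits. -/
def visitedMass (q : Triplet H S A → ℝ) (y : Traj H S A) : ℝ :=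
  ∑ z, q z * if y z.1 = z.2 then 1 else 0

lemma value_eq_sum_trajProb (M : MDP H S A) (π : Policy H S A) (r : Triplet H S A → ℝ) :
    value M π r = ∑ y, trajProb M π y * visitedMass r y := by
  classical
  simp only [value, visitProb, visitedMass, Finset.sum_mul, Finset.mul_sum, Finset.sum_filter]
  rw [Finset.sum_comm]
  refine Finset.sum_congr rfl fun y _ => Finset.sum_congr rfl fun z _ => ?_
  split_ifs <;> simp

lemma IsDistOn.mono {K K' : Finset (Triplet H S A)} (h : K ⊆ K') {q : Triplet H S A → ℝ}
    (hq : IsDistOn K q) : IsDistOn K' q :=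
  ⟨hq.1, fun z hz => hq.2 z fun h' => hz (h h')⟩

lemma IsDistOn.sum_eq_one {K : Finset (Triplet H S A)} {q : Triplet H S A → ℝ}
    (hq : IsDistOn K q) : ∑ z ∈ K, q z = 1 := by
  rw [← hq.1.2]
  exact Finset.sum_subset (Finset.subset_univ _) fun z _ hz => hq.2 z hz

lemma IsDistOn.visitedMass_mem {K : Finset (Triplet H S A)} {q : Triplet H S A → ℝ}
    (hq : IsDistOn K q) (y : Traj H S A) : 0 ≤ visitedMass q y ∧ visitedMass q y ≤ 1 := by
  classical
  constructor
  · exact Finset.sum_nonneg fun z _ => mul_nonneg (hq.1.1 z) (by split_ifs <;> simp)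
  · rw [← hq.1.2]
    exact Finset.sum_le_sum fun z _ => mul_le_of_le_one_right (hq.1.1 z) (by split_ifs <;> simp)

lemma IsDistOn.linLoss_lossVec {K : Finset (Triplet H S A)} {q : Triplet H S A → ℝ}
    (hq : IsDistOn K q) (y : Traj H S A) : linLoss K (lossVec K y) q = visitedMass q y := by
  classical
  unfold linLoss visitedMass
  rw [← Finset.sum_subset (Finset.subset_univ K) fun z _ hz => by rw [hq.2 z hz, zero_mul]]
  exact Finset.sum_congr rfl fun z hz => by simp [lossVec, hz]

lemma IsDistOn.value_nonneg {K : Finset (Triplet H S A)} {q : Triplet H S A → ℝ}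
    (hq : IsDistOn K q) (M : MDP H S A) (π : Policy H S A) : 0 ≤ value M π q :=
  Finset.sum_nonneg fun z _ => mul_nonneg (visitProb_nonneg M π z) (hq.1.1 z)

lemma IsDistOn.value_le_optValue {K : Finset (Triplet H S A)} {q : Triplet H S A → ℝ}
    (hq : IsDistOn K q) (M : MDP H S A) (π : Policy H S A) : value M π q ≤ optValue M q := by
  classical
  refine le_ciSup (f := fun π => value M π q)
    ⟨Fintype.card (Traj H S A), ?_⟩ π
  rintro _ ⟨π', rfl⟩
  simp only [value_eq_sum_trajProb]
  calc _ ≤ ∑ _y : Traj H S A, (1 : ℝ) := Finset.sum_le_sum fun y _ =>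
        mul_le_one₀ (trajProb_mem M π' y).2 (hq.visitedMass_mem y).1 (hq.visitedMass_mem y).2
    _ = _ := by simp

lemma isDistOn_uniformOn {K : Finset (Triplet H S A)} (hK : K.Nonempty) :
    IsDistOn K (uniformOn K) := by
  classical
  refine ⟨⟨fun z => Set.indicator_nonneg (fun _ _ => by positivity) z, ?_⟩,
    fun z hz => Set.indicator_of_notMem (by simpa using hz) _⟩
  have : ∑ z, uniformOn K z = ∑ z ∈ K, (K.card : ℝ)⁻¹ := by
    simp [uniformOn, Set.indicator]
  rw [this, Finset.sum_const, nsmul_eq_mul, mul_inv_cancel₀]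
  exact_mod_cast hK.card_pos.ne'

lemma isDistOn_play (L : OnlineLearner H S A) {K : Finset (Triplet H S A)} (hK : K.Nonempty)
    (ls : List (Triplet H S A → ℝ)) : IsDistOn K (L.play K ls) := by
  cases ls with
  | nil => exact isDistOn_uniformOn hK
  | cons l ls => exact L.weight_mem K hK _

lemma isDistOn_single [DecidableEq (Triplet H S A)] {K : Finset (Triplet H S A)}
    {z : Triplet H S A} (hz : z ∈ K) : IsDistOn K (Pi.single z 1) :=
  ⟨single_mem_stdSimplex ℝ z, fun z' hz' => Pi.single_eq_of_ne (by rintro rfl; exact hz' hz) _⟩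

/-! ### Coverage complexity -/

lemma mem_targetSet {c : Triplet H S A → ℝ} {z : Triplet H S A} : z ∈ targetSet c ↔ 0 < c z := by
  simp [targetSet]

/-- Holds for each ρ separately, and combines homogeneity with monotonicity in the target. All
comparisons between the complexities of c, of 𝟙_𝒳 and of the level sets come from it. -/
lemma ofReal_mul_coverageComplexity_le (M : MDP H S A) {f g : Triplet H S A → ℝ} {a : ℝ}
    (ha : 0 ≤ a) (h : ∀ z, 0 < f z → 0 < g z ∧ a * f z ≤ g z) :
    ENNReal.ofReal a * coverageComplexity M f ≤ coverageComplexity M g := by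
  refine le_iInf₂ fun ρ hρ => ?_
  calc ENNReal.ofReal a * coverageComplexity M f
      ≤ ENNReal.ofReal a
          * ⨆ z ∈ targetSet f, ENNReal.ofReal (f z) / ENNReal.ofReal (ρ z) := by
        gcongr
        exact iInf₂_le ρ hρ
    _ ≤ _ := by
        simp only [ENNReal.mul_iSup]
        refine iSup₂_le fun z hz => ?_
        obtain ⟨h1, h2⟩ := h z (mem_targetSet.1 hz)
        refine le_iSup₂_of_le z (mem_targetSet.2 h1) ?_
        rw [← mul_div_assoc, ← ENNReal.ofReal_mul ha]
        gcongr

lemma coverageComplexity_le (M : MDP H S A) {f g : Triplet H S A → ℝ}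
    (h : ∀ z, 0 < f z → f z ≤ g z) : coverageComplexity M f ≤ coverageComplexity M g := by
  simpa using ofReal_mul_coverageComplexity_le M zero_le_one (f := f) (g := g) fun z hz =>
    ⟨hz.trans_le (h z hz), by simpa using h z hz⟩

/-- The indicator function of `𝒳_k`, as a target function. -/
def levelIndicator (c : Triplet H S A → ℝ) (k : ℕ) : Triplet H S A → ℝ :=
  Set.indicator (levelSet c k : Set (Triplet H S A)) fun _ => 1

lemma levelIndicator_zero (c : Triplet H S A → ℝ) : levelIndicator c 0 = targetIndicator c := by
  simp [levelIndicator, targetIndicator, levelSet]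

lemma mem_of_levelIndicator_pos {c : Triplet H S A → ℝ} {k : ℕ} {z : Triplet H S A}
    (h : 0 < levelIndicator c k z) : z ∈ levelSet c k := by
  by_contra h'
  rw [levelIndicator, Set.indicator_of_notMem (by simpa using h')] at h
  exact lt_irrefl _ h

lemma levelIndicator_of_mem {c : Triplet H S A → ℝ} {k : ℕ} {z : Triplet H S A}
    (h : z ∈ levelSet c k) : levelIndicator c k z = 1 :=
  Set.indicator_of_mem (by simpa using h) _

/-- The easy half of minimax duality: if the visit probabilities of a policy are at least 1 / G on
the whole level set, then so is their average under any `q` supported there, and this average is at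
most the value of the policy for the reward `q`. -/
lemma inv_optValue_le_coverageComplexity (M : MDP H S A) {c : Triplet H S A → ℝ} {k : ℕ}
    {q : Triplet H S A → ℝ} (hK : (levelSet c k).Nonempty) (hq : IsDistOn (levelSet c k) q) :
    (ENNReal.ofReal (optValue M q))⁻¹ ≤ coverageComplexity M (levelIndicator c k) := by
  refine le_iInf₂ fun ρ hρ => ?_
  obtain ⟨π, rfl⟩ := hρ
  rw [ENNReal.inv_le_iff_inv_le]
  set G := ⨆ z ∈ targetSet (levelIndicator c k),
    ENNReal.ofReal (levelIndicator c k z) / ENNReal.ofReal (visitProb M π z) with hG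
  have hle : ∀ z ∈ levelSet c k, G⁻¹ ≤ ENNReal.ofReal (visitProb M π z) := fun z hz => by
    rw [ENNReal.inv_le_iff_inv_le, ← one_div]
    refine le_iSup₂_of_le z (mem_targetSet.2 ?_) ?_ <;> simp [levelIndicator_of_mem hz]
  have hfin : G⁻¹ ≠ ⊤ := by
    obtain ⟨z, hz⟩ := hK
    exact ne_top_of_le_ne_top ENNReal.ofReal_ne_top (hle z hz)
  rw [← ENNReal.ofReal_toReal hfin]
  refine ENNReal.ofReal_le_ofReal (le_trans ?_ (hq.value_le_optValue M π))
  calc (G⁻¹).toReal = ∑ z ∈ levelSet c k, (G⁻¹).toReal * q z := by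
        rw [← Finset.mul_sum, hq.sum_eq_one, mul_one]
    _ ≤ ∑ z ∈ levelSet c k, visitProb M π z * q z := Finset.sum_le_sum fun z hz =>
        mul_le_mul_of_nonneg_right
          (ENNReal.toReal_le_of_le_ofReal (visitProb_nonneg M π z) (hle z hz)) (hq.1.1 z)
    _ ≤ value M π q := Finset.sum_le_sum_of_subset_of_nonneg (Finset.subset_univ _)
        fun z _ _ => mul_nonneg (visitProb_nonneg M π z) (hq.1.1 z)

lemma one_le_coverageComplexity_mul_optValue (M : MDP H S A) {c : Triplet H S A → ℝ} {k : ℕ}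
    {q : Triplet H S A → ℝ} (hK : (levelSet c k).Nonempty) (hq : IsDistOn (levelSet c k) q)
    (hfin : coverageComplexity M (levelIndicator c k) ≠ ⊤) :
    1 ≤ (coverageComplexity M (levelIndicator c k)).toReal * optValue M q := by
  have h := inv_optValue_le_coverageComplexity M hK hq
  -- A zero optimal value would make the complexity infinite.
  have hpos : 0 < optValue M q := by
    by_contra h0
    rw [ENNReal.ofReal_of_nonpos (not_lt.1 h0), ENNReal.inv_zero] at h
    exact hfin (top_le_iff.1 h)
  rw [← ENNReal.ofReal_inv_of_pos hpos] at h
  have h2 := (ENNReal.ofReal_le_iff_le_toReal hfin).1 h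
  rwa [inv_le_iff_one_le_mul₀ hpos] at h2

/-! ### Level sets -/

lemma one_le_cMin (c : Triplet H S A → ℝ) : 1 ≤ cMin c := le_max_right _ _

lemma levelSet_zero (c : Triplet H S A → ℝ) : levelSet c 0 = targetSet c := by simp [levelSet]

lemma mem_levelSet_succ {c : Triplet H S A → ℝ} {k : ℕ} {z : Triplet H S A} :
    z ∈ levelSet c (k + 1) ↔ cMin c * 2 ^ (k + 1) < c z := by
  simp [levelSet]

lemma levelSet_subset_targetSet (c : Triplet H S A → ℝ) (k : ℕ) :
    levelSet c k ⊆ targetSet c := by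
  cases k with
  | zero => rw [levelSet_zero]
  | succ k =>
    intro z hz
    have h1 := one_le_cMin c
    exact mem_targetSet.2 (lt_trans (by positivity) (mem_levelSet_succ.1 hz))

lemma levelSet_succ_subset (c : Triplet H S A → ℝ) (k : ℕ) :
    levelSet c (k + 1) ⊆ levelSet c k := by
  cases k with
  | zero => rw [levelSet_zero]; exact levelSet_subset_targetSet c 1
  | succ k =>
    intro z hz
    rw [mem_levelSet_succ] at hz ⊢
    refine lt_of_le_of_lt ?_ hz
    have h1 := one_le_cMin c
    gcongr <;> norm_num

lemma le_cMax (c : Triplet H S A → ℝ) (z : Triplet H S A) : c z ≤ cMax c :=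
  le_ciSup (Set.finite_range c).bddAbove z

/-- For k ≥ 1, the strict inequality in the definition of 𝒳_k gives k < log₂(c_max / c_min); k = 0
is the reason for the maximum with 1 in m. -/
lemma lt_numPhases {c : Triplet H S A → ℝ} {k : ℕ} (hk : (levelSet c k).Nonempty) :
    k < numPhases c := by
  cases k with
  | zero => exact lt_of_lt_of_le zero_lt_one (le_max_right _ _)
  | succ k =>
    obtain ⟨z, hz⟩ := hk
    have h1 := one_le_cMin c
    have h2 := (mem_levelSet_succ.1 hz).trans_le (le_cMax c z)
    refine lt_of_lt_of_le ?_ (le_max_left _ _)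
    rw [Nat.lt_ceil, Real.lt_logb_iff_rpow_lt one_lt_two, Real.rpow_natCast,
      lt_div_iff₀ (by linarith)]
    · linarith
    · have : 0 < cMin c * 2 ^ (k + 1) := by positivity
      exact div_pos (this.trans h2) (by linarith)

/-! ### Runs of CovGame -/

open Classical in
lemma visitCount_cons (y : Traj H S A) (hist : List (Traj H S A)) (z : Triplet H S A) :
    visitCount (y :: hist) z = visitCount hist z + if y z.1 = z.2 then 1 else 0 := by
  simp [visitCount, List.countP_cons]

lemma visitCount_past_mono (y : ℕ → Traj H S A) (z : Triplet H S A) :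
    Monotone fun t => visitCount (past y t) z :=
  monotone_nat_of_le_succ fun t => by
    classical
    simp only [past, visitCount_cons]
    exact Nat.le_add_right _ _

open Classical in
lemma visitCount_past_eq_sum (y : ℕ → Traj H S A) (z : Triplet H S A) (t : ℕ) :
    (visitCount (past y t) z : ℝ) = ∑ s ∈ Finset.range t, if y s z.1 = z.2 then (1 : ℝ) else 0 := by
  induction t with
  | zero => simp [past, visitCount]
  | succ t ih => rw [Finset.sum_range_succ, ← ih, past, visitCount_cons]; push_cast; rfl

/-- All sampling requirements are met after the trajectories `hist`. -/
def Covered (c : Triplet H S A → ℝ) (hist : List (Traj H S A)) : Prop :=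
  ∀ z, c z ≤ visitCount hist z

lemma covered_iff {c : Triplet H S A → ℝ} {hist : List (Traj H S A)} :
    Covered c hist ↔ ∀ z ∈ targetSet c, c z ≤ visitCount hist z := by
  refine ⟨fun h z _ => h z, fun h z => ?_⟩
  by_cases hz : z ∈ targetSet c
  · exact h z hz
  · rw [mem_targetSet, not_lt] at hz
    exact hz.trans (Nat.cast_nonneg _)

lemma covGameState_cons_fst (c : Triplet H S A → ℝ) (y : Traj H S A) (hist : List (Traj H S A)) :
    (covGameState c (y :: hist)).1 = newLevel c (y :: hist) := by
  simp only [covGameState]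
  split_ifs with h
  · rfl
  · exact (not_not.1 h).symm

lemma levels_bddAbove {c : Triplet H S A → ℝ} {hist : List (Traj H S A)}
    (h : ¬ Covered c hist) :
    BddAbove {j : ℕ | ∀ z ∈ targetSet c, z ∉ levelSet c j → c z ≤ visitCount hist z} := by
  refine ⟨numPhases c, fun j hj => ?_⟩
  by_contra h'
  refine h (covered_iff.2 fun z hz => hj z hz fun hz' => h' ?_)
  exact (lt_numPhases ⟨z, hz'⟩).le

lemma zero_mem_levels (c : Triplet H S A → ℝ) (hist : List (Traj H S A)) :
    0 ∈ {j : ℕ | ∀ z ∈ targetSet c, z ∉ levelSet c j → c z ≤ visitCount hist z} :=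
  fun z hz hz' => absurd (by rwa [levelSet_zero]) hz'

lemma newLevel_mem {c : Triplet H S A → ℝ} {hist : List (Traj H S A)}
    (h : ¬ Covered c hist) :
    ∀ z ∈ targetSet c, z ∉ levelSet c (newLevel c hist) → c z ≤ visitCount hist z :=
  Nat.sSup_mem ⟨0, zero_mem_levels c hist⟩ (levels_bddAbove h)

lemma levelSet_newLevel_nonempty {c : Triplet H S A → ℝ} (hc : (targetSet c).Nonempty)
    (hist : List (Traj H S A)) : (levelSet c (newLevel c hist)).Nonempty := by
  by_cases h : Covered c hist
  -- After coverage every `j` is admissible, the set is unbounded and `sSup` defaults to 0. The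
  -- fictitious continuation thus plays on 𝒳, so that rewards are distributions after every history,
  -- as the RL regret assumption demands.
  · have : {j : ℕ | ∀ z ∈ targetSet c, z ∉ levelSet c j → c z ≤ visitCount hist z} = Set.univ :=
      Set.eq_univ_of_forall fun j z _ _ => h z
    rw [newLevel, this, Nat.sSup_of_not_bddAbove (by simp), levelSet_zero]
    exact hc
  · by_contra h'
    rw [Finset.not_nonempty_iff_eq_empty] at h'
    exact h (covered_iff.2 fun z hz => newLevel_mem h z hz (by simp [h']))

lemma levelSet_covGameState_nonempty {c : Triplet H S A → ℝ} (hc : (targetSet c).Nonempty)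
    (hist : List (Traj H S A)) : (levelSet c (covGameState c hist).1).Nonempty := by
  cases hist with
  | nil => simpa [covGameState, levelSet_zero] using hc
  | cons y hist => rw [covGameState_cons_fst]; exact levelSet_newLevel_nonempty hc _

lemma isDistOn_covGameReward {c : Triplet H S A → ℝ} (hc : (targetSet c).Nonempty)
    (L : OnlineLearner H S A) (hist : List (Traj H S A)) :
    IsDistOn (levelSet c (covGameState c hist).1) (covGameReward c L hist) :=
  isDistOn_play L (levelSet_covGameState_nonempty hc hist) _

/-- As long as CovGame runs, some triplet of the current level set that is not in the next one
misses samples. -/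
lemma exists_uncovered {c : Triplet H S A → ℝ} {hist : List (Traj H S A)}
    (h : ¬ Covered c hist) :
    ∃ z ∈ levelSet c (covGameState c hist).1, c z ≤ cMin c * 2 ^ ((covGameState c hist).1 + 1) ∧
      visitCount hist z < c z := by
  cases hist with
  | nil =>
    have hne : (targetSet c).Nonempty := by
      by_contra h'
      rw [Finset.not_nonempty_iff_eq_empty] at h'
      exact h (covered_iff.2 (by simp [h']))
    -- At the start the level is 0 by decree rather than by maximality; a triplet of smallest
    -- positive requirement serves as witness.
    obtain ⟨z, hz, hmin⟩ := Finset.exists_min_image _ c hne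
    refine ⟨z, by simpa [covGameState, levelSet_zero] using hz, ?_, ?_⟩
    · have : Nonempty {z // z ∈ targetSet c} := ⟨⟨z, hz⟩⟩
      have h1 : c z ≤ cMin c := (le_ciInf fun z' : {z // z ∈ targetSet c} => hmin z'.1 z'.2).trans (le_max_left _ _)
      have h2 := one_le_cMin c
      simp only [covGameState, zero_add, pow_one]
      linarith
    · simpa [visitCount] using mem_targetSet.1 hz
  | cons y hist =>
    rw [covGameState_cons_fst]
    set k := newLevel c (y :: hist) with hk
    -- Maximality of the level yields an undersampled triplet outside 𝒳_(k+1); admissibility of `k`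
    -- itself then puts it in 𝒳_k.
    have h1 : k + 1 ∉ {j : ℕ | ∀ z ∈ targetSet c, z ∉ levelSet c j →
        c z ≤ visitCount (y :: hist) z} := fun h' => by
      have : k + 1 ≤ k := le_csSup (levels_bddAbove h) h'
      omega
    simp only [Set.mem_ofPred_eq, not_forall, not_le] at h1
    obtain ⟨z, hz, hz1, hz2⟩ := h1
    refine ⟨z, ?_, not_lt.1 fun h' => hz1 (mem_levelSet_succ.2 h'), hz2⟩
    by_contra h'
    exact absurd (newLevel_mem h z hz h') (not_le.2 hz2)

lemma not_covered_of_le {c : Triplet H S A → ℝ} {y : ℕ → Traj H S A} {s t : ℕ} (hst : s ≤ t)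
    (h : ¬ Covered c (past y t)) : ¬ Covered c (past y s) := fun h' => h fun z =>
  (h' z).trans (by exact_mod_cast visitCount_past_mono y z hst)

/-- Visit counts grow, so an admissible level stays admissible. Noncoverage at `T` is needed because
the level falls back to 0 after coverage. -/
lemma covGameState_fst_mono {c : Triplet H S A → ℝ} {y : ℕ → Traj H S A} {T : ℕ}
    (h : ¬ Covered c (past y T)) (s t : ℕ) (hst : s ≤ t) (htT : t ≤ T) :
    (covGameState c (past y s)).1 ≤ (covGameState c (past y t)).1 := by
  cases s with
  | zero => simp [past, covGameState]
  | succ s =>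
    obtain ⟨t, rfl⟩ : ∃ t', t = t' + 1 := ⟨t - 1, by omega⟩
    have hs := newLevel_mem (not_covered_of_le (hst.trans htT) h)
    simp only [past] at hs ⊢
    rw [covGameState_cons_fst, covGameState_cons_fst]
    refine le_csSup (levels_bddAbove (not_covered_of_le htT h)) fun z hz hz' => ?_
    exact (hs z hz hz').trans (by exact_mod_cast visitCount_past_mono y z hst)

/-- The memory is empty at `a`, either because the run starts there or because the level has just
changed, and no reset occurs within the phase. This identifies the play in a phase with that of a
fresh learner. -/
lemma covGameState_snd_of_phase {c : Triplet H S A → ℝ} {y : ℕ → Traj H S A} {a j : ℕ}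
    (ha : a = 0 ∨ (covGameState c (past y (a - 1))).1 ≠ j) (i : ℕ)
    (hj : ∀ s, a ≤ s → s ≤ a + i → (covGameState c (past y s)).1 = j) :
    (covGameState c (past y (a + i))).2
      = past (fun i => lossVec (levelSet c j) (y (a + i))) i := by
  induction i with
  | zero =>
    have h := hj a le_rfl le_rfl
    cases a with
    | zero => rfl
    | succ a =>
      have ha' := ha.resolve_left (Nat.succ_ne_zero a)
      simp only [Nat.add_sub_cancel] at ha'
      simp only [past] at h ⊢
      rw [covGameState_cons_fst] at h
      have hne : newLevel c (y a :: past y a) ≠ (covGameState c (past y a)).1 := by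
        rw [h]; exact ha'.symm
      simp [covGameState, hne]
  | succ i ih =>
    have h0 := hj (a + i) (by omega) (by omega)
    have h1 := hj (a + i + 1) (by omega) (by omega)
    have ih' := ih fun s hs hs' => hj s hs (by omega)
    rw [← add_assoc]
    simp only [past] at h1 ⊢
    rw [covGameState_cons_fst] at h1
    simp only [covGameState, h1, h0, ih', ne_eq, not_true_eq_false, if_false]

/-- The regret bound is applied to losses that vanish identically. -/
lemma OnlineFirstOrderRegret.nonneg {c : Triplet H S A → ℝ} {L : OnlineLearner H S A}
    {R : ℕ → ℝ} (h : OnlineFirstOrderRegret c L R) (hc : (targetSet c).Nonempty) {T : ℕ}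
    (hT : 1 ≤ T) : 0 ≤ R T := by
  have hK : (levelSet c 0).Nonempty := by rwa [levelSet_zero]
  have := h.2 0 hK (fun _ _ => 0) (by simp) (by simp) T hT _ (isDistOn_uniformOn hK)
  simpa [linLoss] using this

lemma sqrt_mul_le_half_add {a b : ℝ} (ha : 0 ≤ a) (hb : 0 ≤ b) : √(a * b) ≤ (a + b) / 2 := by
  rw [Real.sqrt_le_left (by positivity)]
  nlinarith [sq_nonneg (a - b)]

/-- The weight that the online learner collects during a phase. -/
lemma sum_visitedMass_phase_le {c : Triplet H S A → ℝ} {L : OnlineLearner H S A} {R : ℕ → ℝ}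
    (hL : OnlineFirstOrderRegret c L R) (hc : (targetSet c).Nonempty) {y : ℕ → Traj H S A}
    {a b j T : ℕ} (hab : a < b) (hbT : b ≤ T) (hT : ¬ Covered c (past y T))
    (ha : a = 0 ∨ (covGameState c (past y (a - 1))).1 ≠ j)
    (hj : ∀ s, a ≤ s → s < b → (covGameState c (past y s)).1 = j) :
    ∃ z ∈ levelSet c j, c z ≤ cMin c * 2 ^ (j + 1) ∧
      ∑ t ∈ Finset.Ico a b, visitedMass (covGameReward c L (past y t)) (y t)
        ≤ 2 * (c z + 1) + 3 * R T := by
  classical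
  -- Taken before the last episode `b - 1` of the phase: that episode adds at most one visit, whence
  -- the comparator loss `c z + 1`.
  obtain ⟨z, hz, hz1, hz2⟩ := exists_uncovered (not_covered_of_le (by omega : b - 1 ≤ T) hT)
  rw [hj (b - 1) (by omega) (by omega)] at hz hz1
  refine ⟨z, hz, hz1, ?_⟩
  set K := levelSet c j with hK
  -- The loss of episode `b - 1` is included even though a reset may keep it from the learner: the
  -- weights played up to that episode do not depend on it.
  set l : ℕ → Triplet H S A → ℝ := fun i => lossVec K (y (a + i)) with hl
  have hplay : ∀ i < b - a, linLoss K (l i) (L.play K (past l i))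
      = visitedMass (covGameReward c L (past y (a + i))) (y (a + i)) := fun i hi => by
    have h1 : covGameReward c L (past y (a + i)) = L.play K (past l i) := by
      rw [covGameReward, hj (a + i) (by omega) (by omega),
        covGameState_snd_of_phase ha i fun s hs hs' => hj s hs (by omega)]
    rw [h1, hl, (isDistOn_play L ⟨z, hz⟩ _).linLoss_lossVec]
  have hreg := hL.2 j ⟨z, hz⟩ l
    (fun t z => by simp only [hl, lossVec]; split_ifs <;> simp)
    (fun t z hz => by simp [hl, lossVec, show z ∉ K from hz]) (b - a) (by omega)
    _ (isDistOn_single hz)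
  rw [← hK, Finset.sum_congr rfl fun i hi => hplay i (Finset.mem_range.1 hi),
    ← Finset.sum_Ico_eq_sum_range
      (fun t => visitedMass (covGameReward c L (past y t)) (y t))] at hreg
  set B := ∑ t ∈ Finset.Ico a b, visitedMass (covGameReward c L (past y t)) (y t) with hB
  have hB0 : 0 ≤ B := Finset.sum_nonneg fun t _ =>
    ((isDistOn_covGameReward hc L (past y t)).visitedMass_mem (y t)).1
  have hsingle : ∑ i ∈ Finset.range (b - a), linLoss K (l i) (Pi.single z 1) ≤ c z + 1 := by
    have h1 : ∀ i, linLoss K (l i) (Pi.single z 1)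
        = if y (a + i) z.1 = z.2 then (1 : ℝ) else 0 := fun i => by
      rw [hl, (isDistOn_single hz).linLoss_lossVec, visitedMass,
        Finset.sum_eq_single z (fun z' _ h => by simp [Pi.single_eq_of_ne h]) (by simp)]
      simp
    simp only [h1]
    rw [← Finset.sum_Ico_eq_sum_range (fun t => if y t z.1 = z.2 then (1 : ℝ) else 0)]
    calc ∑ t ∈ Finset.Ico a b, (if y t z.1 = z.2 then (1 : ℝ) else 0)
        ≤ ∑ t ∈ Finset.range b, (if y t z.1 = z.2 then (1 : ℝ) else 0) :=
          Finset.sum_le_sum_of_subset_of_nonneg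
            (fun t ht => Finset.mem_range.2 (Finset.mem_Ico.1 ht).2)
            fun t _ _ => by split_ifs <;> simp
      _ = ∑ t ∈ Finset.range (b - 1), (if y t z.1 = z.2 then (1 : ℝ) else 0)
            + if y (b - 1) z.1 = z.2 then (1 : ℝ) else 0 := by
          rw [← Finset.sum_range_succ, Nat.sub_add_cancel (by omega)]
      _ ≤ c z + 1 := by
          rw [← visitCount_past_eq_sum]
          exact add_le_add hz2.le (by split_ifs <;> simp)
  have hRmono : R (b - a) ≤ R T := hL.1 (Set.mem_Ici.2 (by omega)) (Set.mem_Ici.2 (by omega))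
    (by omega)
  have hR0 : 0 ≤ R (b - a) := hL.nonneg hc (by omega)
  -- AM-GM absorbs half of the collected weight B into the left side, leaving B ≤ 2 (c z + 1) + 3 R.
  have := sqrt_mul_le_half_add hR0 hB0
  linarith

/-! ### Bounds on the number of episodes -/

lemma coverageComplexity_ne_top (M : MDP H S A) {c : Triplet H S A → ℝ}
    (hc : (targetSet c).Nonempty) (hfin : coverageComplexity M (targetIndicator c) ≠ ⊤) :
    coverageComplexity M c ≠ ⊤ := by
  obtain ⟨z, hz⟩ := hc
  have hpos : 0 < cMax c := (mem_targetSet.1 hz).trans_le (le_cMax c z)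
  have h := ofReal_mul_coverageComplexity_le M (inv_nonneg.2 hpos.le)
    (f := c) (g := targetIndicator c) fun z hz => by
      have h1 : targetIndicator c z = 1 :=
        Set.indicator_of_mem (by simpa using mem_targetSet.2 hz) _
      rw [h1, inv_mul_le_iff₀ hpos, mul_one]
      exact ⟨one_pos, le_cMax c z⟩
  intro htop
  rw [htop, ENNReal.mul_top (by simpa using hpos), top_le_iff] at h
  exact hfin h

lemma coverageComplexity_levelIndicator_antitone (M : MDP H S A) (c : Triplet H S A → ℝ) :
    Antitone fun k => coverageComplexity M (levelIndicator c k) :=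
  antitone_nat_of_succ_le fun k => coverageComplexity_le M fun z hz => by
    have h := mem_of_levelIndicator_pos hz
    rw [levelIndicator_of_mem h, levelIndicator_of_mem (levelSet_succ_subset c k h)]

lemma coverageComplexity_levelIndicator_ne_top (M : MDP H S A) {c : Triplet H S A → ℝ}
    (hfin : coverageComplexity M (targetIndicator c) ≠ ⊤) (k : ℕ) :
    coverageComplexity M (levelIndicator c k) ≠ ⊤ :=
  ne_top_of_le_ne_top (b := coverageComplexity M (levelIndicator c 0))
    (by rwa [levelIndicator_zero])
    (coverageComplexity_levelIndicator_antitone M c (Nat.zero_le k))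

/-- If c ≥ c_min 2^k on 𝒳_k, then c_min 2^k Φ_k ≤ φ⋆(c), and c z is at most twice c_min 2^k; the
extra 1 costs Φ_k ≤ φ⋆(𝟙_𝒳). This can only fail for k = 0 when the truncation at 1 makes c_min = 1;
then c z + 1 ≤ 3. -/
lemma coverageComplexity_level_mul_le (M : MDP H S A) {c : Triplet H S A → ℝ}
    (hfin : coverageComplexity M (targetIndicator c) ≠ ⊤) {k : ℕ} {z : Triplet H S A}
    (hz : z ∈ levelSet c k) (hcz : c z ≤ cMin c * 2 ^ (k + 1)) :
    (coverageComplexity M (levelIndicator c k)).toReal * (c z + 1)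
      ≤ 2 * (coverageComplexity M c).toReal
        + 3 * (coverageComplexity M (targetIndicator c)).toReal := by
  have hc : (targetSet c).Nonempty := ⟨z, levelSet_subset_targetSet c k hz⟩
  have h1 := one_le_cMin c
  set Φ := (coverageComplexity M (levelIndicator c k)).toReal with hΦ
  have hΦX : Φ ≤ (coverageComplexity M (targetIndicator c)).toReal := by
    refine ENNReal.toReal_mono hfin ?_
    rw [← levelIndicator_zero]
    exact coverageComplexity_levelIndicator_antitone M c (Nat.zero_le k)
  have hΦ0 : 0 ≤ Φ := ENNReal.toReal_nonneg
  have hc0 : 0 ≤ (coverageComplexity M c).toReal := ENNReal.toReal_nonneg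
  by_cases hlow : ∀ z ∈ levelSet c k, cMin c * 2 ^ k ≤ c z
  · have h2 := ENNReal.toReal_mono (coverageComplexity_ne_top M hc hfin)
      (ofReal_mul_coverageComplexity_le M (by positivity : 0 ≤ cMin c * 2 ^ k)
        (f := levelIndicator c k) (g := c) fun z hz => by
          have h := mem_of_levelIndicator_pos hz
          rw [levelIndicator_of_mem h, mul_one]
          exact ⟨mem_targetSet.1 (levelSet_subset_targetSet c k h), hlow z h⟩)
    rw [ENNReal.toReal_mul, ENNReal.toReal_ofReal (by positivity), ← hΦ] at h2
    have h3 := mul_le_mul_of_nonneg_left hcz hΦ0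
    rw [pow_succ] at h3
    nlinarith
  · have hk : k = 0 := by
      by_contra hk
      obtain ⟨k, rfl⟩ := Nat.exists_eq_succ_of_ne_zero hk
      exact hlow fun z hz => (mem_levelSet_succ.1 hz).le
    have hmin : cMin c ≤ 1 := by
      by_contra h'
      refine hlow fun z hz => ?_
      have h4 : cMin c = ⨅ z : {z // z ∈ targetSet c}, c z :=
        max_eq_left (le_of_lt (by
          by_contra h5
          exact h' (max_le (not_lt.1 h5) le_rfl)))
      rw [hk, pow_zero, mul_one, h4]
      exact ciInf_le (Set.finite_range _).bddBelow
        (⟨z, levelSet_subset_targetSet c k hz⟩ : {z // z ∈ targetSet c})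
    rw [hk, zero_add, pow_one] at hcz
    have h3 : Φ * (c z + 1) ≤ Φ * 3 := mul_le_mul_of_nonneg_left (by linarith) hΦ0
    linarith

/-- An upper bound on the number of episodes during which CovGame runs, on the event where the
regret and deviation bounds hold. -/
lemma episodes_le_of_not_covered (M : MDP H S A) {c : Triplet H S A → ℝ} {L : OnlineLearner H S A}
    {R : ℕ → ℝ} (hL : OnlineFirstOrderRegret c L R) (hc : (targetSet c).Nonempty)
    (hfin : coverageComplexity M (targetIndicator c) ≠ ⊤) {y : ℕ → Traj H S A} {T : ℕ}
    (hT1 : 1 ≤ T) (hT : ¬ Covered c (past y T)) {V : ℕ → ℝ} (hV : ∀ t, 0 ≤ V t) {Rp ℓ : ℝ}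
    (hRp : 0 ≤ Rp) (hℓ : 0 ≤ ℓ)
    (hreg : ∀ t, 1 ≤ t → t ≤ T →
      ∑ s ∈ Finset.range t, optValue M (covGameReward c L (past y s)) - ∑ s ∈ Finset.range t, V s
        ≤ √(Rp * ∑ s ∈ Finset.range t, V s) + Rp)
    (hdev : ∀ t, 1 ≤ t → t ≤ T → ∑ s ∈ Finset.range t, V s
      ≤ 2 * ∑ s ∈ Finset.range t, visitedMass (covGameReward c L (past y s)) (y s) + 2 * ℓ) :
    (T : ℝ) ≤ numPhases c * (12 * (coverageComplexity M c).toReal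
        + (18 + 9 * R T) * (coverageComplexity M (targetIndicator c)).toReal)
      + (coverageComplexity M (targetIndicator c)).toReal * (3 * ℓ + 3 / 2 * Rp) := by
  set m := numPhases c with hm
  have hm1 : 1 ≤ m := le_max_right _ _
  set φc := (coverageComplexity M c).toReal with hφc
  set φX := (coverageComplexity M (targetIndicator c)).toReal with hφX
  set Φ : ℕ → ℝ := fun k => (coverageComplexity M (levelIndicator c k)).toReal with hΦ
  have hΦanti : Antitone Φ := fun i j hij =>
    ENNReal.toReal_mono (coverageComplexity_levelIndicator_ne_top M hfin i)
      (coverageComplexity_levelIndicator_antitone M c hij)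
  have hΦ0 : ∀ k, 0 ≤ Φ k := fun k => ENNReal.toReal_nonneg
  have hΦX : Φ 0 = φX := by simp only [hΦ, levelIndicator_zero, hφX]
  have hR0 : 0 ≤ R T := hL.nonneg hc hT1
  set k : ℕ → ℕ := fun t => (covGameState c (past y t)).1 with hk
  have hdist : ∀ t, IsDistOn (levelSet c (k t)) (covGameReward c L (past y t)) := fun t =>
    isDistOn_covGameReward hc L (past y t)
  have hkm : ∀ t, k t < m := fun t => lt_numPhases (levelSet_covGameState_nonempty hc _)
  set o : ℕ → ℝ := fun t => optValue M (covGameReward c L (past y t)) with ho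
  have hΦo : ∀ t, 1 ≤ Φ (k t) * o t := fun t =>
    one_le_coverageComplexity_mul_optValue M (levelSet_covGameState_nonempty hc _) (hdist t)
      (coverageComplexity_levelIndicator_ne_top M hfin _)
  -- Phase `j` consists of the episodes from `θ j` up to, but excluding, `θ (j + 1)`; it is empty if
  -- level `j` is skipped.
  choose θ hθT hθ using exists_threshold (covGameState_fst_mono hT)
  have hθ0 : θ 0 = 0 := by
    by_contra h
    exact absurd ((hθ 0 0 hT1).1 (Nat.pos_of_ne_zero h)) (Nat.not_lt_zero _)
  have hθm : θ m = T := by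
    refine le_antisymm (hθT m) (not_lt.1 fun h => ?_)
    exact lt_irrefl _ ((hθ m _ h).2 (hkm _))
  have hθmono : Monotone θ := fun i j hij => by
    by_contra h
    have h' := not_le.1 h
    have hlt := h'.trans_le (hθT i)
    exact lt_irrefl _ ((hθ j _ hlt).2 (((hθ i _ hlt).1 h').trans_le hij))
  have hphase : ∀ j t, θ j ≤ t → t < θ (j + 1) → k t = j := fun j t h1 h2 => by
    have hlt := h2.trans_le (hθT _)
    have h3 := (hθ _ _ hlt).1 h2
    have h4 := mt (hθ j t hlt).2 (not_lt.2 h1)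
    simp only [hk]
    omega
  have hN : ∀ j, ∃ N : ℝ, 0 ≤ N ∧
      ∑ t ∈ Finset.Ico (θ j) (θ (j + 1)), visitedMass (covGameReward c L (past y t)) (y t)
        ≤ 2 * N + 3 * R T ∧ Φ j * N ≤ 2 * φc + 3 * φX := fun j => by
    rcases (hθmono (Nat.le_succ j)).lt_or_eq with h | h
    · obtain ⟨z, hz, hz1, hz2⟩ := sum_visitedMass_phase_le hL hc h (hθT _) hT
        (j := j) (by
          by_cases h0 : θ j = 0
          · exact Or.inl h0
          · refine Or.inr (ne_of_lt ((hθ j _ ?_).1 ?_))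
            · have := hθT j
              omega
            · omega) (hphase j)
      refine ⟨c z + 1, ?_, hz2, coverageComplexity_level_mul_le M hfin hz hz1⟩
      have := mem_targetSet.1 (levelSet_subset_targetSet c j hz)
      linarith
    · refine ⟨0, le_rfl, ?_, ?_⟩
      · rw [← Nat.succ_eq_add_one, ← h]
        simpa using hR0
      · have h1 : 0 ≤ φc := ENNReal.toReal_nonneg
        have h2 : 0 ≤ φX := ENNReal.toReal_nonneg
        linarith
  choose N hN0 hNle hNΦ using hN
  set b : ℝ := 3 * ℓ + 3 / 2 * Rp with hb
  have hb0 : 0 ≤ b := by positivity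
  -- Each nonempty prefix of phases pays the additive cost `b` of the RL regret and the deviation
  -- bound once. It is charged to index 0, so it is finally multiplied by Φ_0 = φ⋆(𝟙_𝒳) without a
  -- factor `m`.
  set g : ℕ → ℝ := fun i => 6 * N i + 9 * R T + if i = 0 then b else 0 with hg
  have hg0 : ∀ i, 0 ≤ g i := fun i => by
    have := hN0 i
    simp only [hg]
    split_ifs <;> positivity
  have hprefix : ∀ j ≤ m, ∑ i ∈ Finset.range j, ∑ t ∈ Finset.Ico (θ i) (θ (i + 1)), o t
      ≤ ∑ i ∈ Finset.range j, g i := by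
    intro j hj
    rw [← sum_range_eq_sum_phases θ hθmono hθ0]
    rcases Nat.eq_zero_or_pos (θ j) with h0 | h0
    · rw [h0]
      simpa using Finset.sum_nonneg fun i _ => hg0 i
    have hj0 : j ≠ 0 := by rintro rfl; omega
    have h1 := hreg _ h0 (hθT j)
    have h2 := hdev _ h0 (hθT j)
    -- The optimal values sum to at most (3/2) ∑ V + (3/2) Rp, and `h2` bounds ∑ V by twice the
    -- collected weight plus 2ℓ; this is the origin of the factor 3 in `h5` and of both terms of
    -- `b`.
    have h3 := sqrt_mul_le_half_add hRp
      (Finset.sum_nonneg fun s (_ : s ∈ Finset.range (θ j)) => hV s)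
    rw [sum_range_eq_sum_phases θ hθmono hθ0
      (fun s => visitedMass (covGameReward c L (past y s)) (y s))] at h2
    have h4 := Finset.sum_le_sum fun i (_ : i ∈ Finset.range j) => hNle i
    have h5 : ∑ i ∈ Finset.range j, g i
        = 3 * ∑ i ∈ Finset.range j, (2 * N i + 3 * R T) + b := by
      simp only [hg]
      rw [Finset.sum_add_distrib, Finset.sum_ite_eq', if_pos (Finset.mem_range.2 (by omega)),
        Finset.mul_sum]
      congr 1
      exact Finset.sum_congr rfl fun i _ => by ring
    rw [h5]
    simp only [ho, hb]
    linarith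
  have hmaj := sum_mul_le_of_prefix_sum_le hΦanti hΦ0 m hprefix
  have hleft : (T : ℝ) ≤ ∑ i ∈ Finset.range m, Φ i * ∑ t ∈ Finset.Ico (θ i) (θ (i + 1)), o t := by
    have h1 : (T : ℝ) = ∑ t ∈ Finset.range (θ m), (1 : ℝ) := by simp [hθm]
    rw [h1, sum_range_eq_sum_phases θ hθmono hθ0]
    refine Finset.sum_le_sum fun i _ => ?_
    rw [Finset.mul_sum]
    refine Finset.sum_le_sum fun t ht => ?_
    rw [Finset.mem_Ico] at ht
    simpa only [hphase i t ht.1 ht.2] using hΦo t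
  have hright : ∑ i ∈ Finset.range m, Φ i * g i
      ≤ m * (12 * φc + (18 + 9 * R T) * φX) + φX * b := by
    have h1 : ∑ i ∈ Finset.range m, Φ i * g i
        = ∑ i ∈ Finset.range m, (6 * (Φ i * N i) + 9 * R T * Φ i) + φX * b := by
      have h2 : Φ 0 * b = ∑ i ∈ Finset.range m, if i = 0 then Φ i * b else 0 := by
        rw [Finset.sum_ite_eq', if_pos (Finset.mem_range.2 (by omega))]
      rw [← hΦX, h2, ← Finset.sum_add_distrib]
      refine Finset.sum_congr rfl fun i _ => ?_
      simp only [hg]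
      split_ifs <;> ring
    rw [h1]
    gcongr
    calc _ ≤ ∑ _i ∈ Finset.range m, (12 * φc + (18 + 9 * R T) * φX) := by
          refine Finset.sum_le_sum fun i _ => ?_
          have h3 := hNΦ i
          have h4 : Φ i ≤ φX := hΦX ▸ hΦanti (Nat.zero_le i)
          have h5 := mul_le_mul_of_nonneg_left h4 hR0
          linarith
      _ = _ := by rw [Finset.sum_const, Finset.card_range, nsmul_eq_mul]
  exact hleft.trans (hmaj.trans hright)

/-! ### Measurability along a run -/

section Runs

variable {Ξ : Type x} [MeasurableSpace Ξ] {Ω : Type u} [mΩ : MeasurableSpace Ω]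

lemma measurableSet_past_eq {ℱ : Filtration ℕ mΩ} {Y : ℕ → Ω → Traj H S A}
    (hY : ∀ t y, MeasurableSet[ℱ (t + 1)] {ω | Y t ω = y}) (t : ℕ) (hist : List (Traj H S A)) :
    MeasurableSet[ℱ t] {ω | past (fun j => Y j ω) t = hist} := by
  induction t generalizing hist with
  | zero => simp only [past]; exact MeasurableSet.const _
  | succ t ih =>
    cases hist with
    | nil => simp [past]
    | cons y hist =>
      have : {ω | past (fun j => Y j ω) (t + 1) = y :: hist}
          = {ω | Y t ω = y} ∩ {ω | past (fun j => Y j ω) t = hist} := by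
        ext ω; simp [past]
      rw [this]
      exact (hY t y).inter (ℱ.mono (Nat.le_succ t) _ (ih hist))

/-- There are only countably many histories, so measurability in the seed for each fixed history
suffices; the dependence on the history may be arbitrary. -/
lemma measurable_comp_seed_past {ℱ : Filtration ℕ mΩ} {ξ : Ω → Ξ} {Y : ℕ → Ω → Traj H S A}
    (hξ : Measurable[ℱ 0] ξ) (hY : ∀ t y, MeasurableSet[ℱ (t + 1)] {ω | Y t ω = y})
    {F : Ξ → List (Traj H S A) → ℝ} (hF : ∀ hist, Measurable fun e => F e hist) (t : ℕ) :
    Measurable[ℱ t] fun ω => F (ξ ω) (past (fun j => Y j ω) t) := by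
  intro s hs
  have : (fun ω => F (ξ ω) (past (fun j => Y j ω) t)) ⁻¹' s
      = ⋃ hist : List (Traj H S A), {ω | past (fun j => Y j ω) t = hist} ∩
          (fun ω => F (ξ ω) hist) ⁻¹' s := by
    ext ω; simp
  rw [this]
  have hξ' : Measurable[ℱ t] ξ := hξ.mono (ℱ.mono (Nat.zero_le t)) le_rfl
  exact MeasurableSet.iUnion fun hist =>
    (measurableSet_past_eq hY t hist).inter (((hF hist).comp hξ') hs)

lemma measurable_trajProb_act (M : MDP H S A) (P : RLLearner H S A Ξ) (δ : ℝ)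
    (hist : List ((Triplet H S A → ℝ) × Traj H S A)) (r : Triplet H S A → ℝ) (y : Traj H S A) :
    Measurable fun e => trajProb M (P.act δ e hist r) y :=
  Finset.measurable_prod _ fun h _ => measurable_const.mul (P.act_meas δ hist r h _ _)

/-- By `value_eq_sum_trajProb`, the value of the played policy is the conditional mean of the weight
visited by the trajectory. -/
lemma IsRun.measure_value_deviation_le {M : MDP H S A} {P : RLLearner H S A Ξ} {δ' : ℝ}
    {rew : List (Traj H S A) → Triplet H S A → ℝ} {μ : Measure Ω} [IsProbabilityMeasure μ]
    {ℱ : Filtration ℕ mΩ} {ξ : Ω → Ξ} {Y : ℕ → Ω → Traj H S A}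
    (hrun : IsRun M P δ' rew μ ℱ ξ Y) {K : Finset (Triplet H S A)}
    (hrew : ∀ hist, IsDistOn K (rew hist)) {T : ℕ} {ε : ℝ} (hT : 1 ≤ T) (hε : 0 < ε) :
    μ {ω | ∀ t, 1 ≤ t → t ≤ T →
        ∑ s ∈ Finset.range t, value M (policyAt P δ' rew ξ Y s ω) (rewardAt rew Y s ω)
          ≤ 2 * ∑ s ∈ Finset.range t, visitedMass (rewardAt rew Y s ω) (Y s ω)
            + 2 * Real.log (T / ε)}ᶜ ≤ ENNReal.ofReal ε := by
  classical
  simp only [value_eq_sum_trajProb]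
  exact measure_sum_deviation_le ℱ (Y := Y)
    (p := fun s y ω => trajProb M (policyAt P δ' rew ξ Y s ω) y)
    (x := fun s y ω => visitedMass (rewardAt rew Y s ω) y) hrun.traj_meas
    (fun t y => measurable_comp_seed_past hrun.seed_meas hrun.traj_meas
      (F := fun e hist => trajProb M (P.act δ' e (feedback rew hist) (rew hist)) y)
      (fun hist => measurable_trajProb_act M P δ' _ _ y) t)
    (fun t y ω => trajProb_mem M _ y)
    (fun t y => measurable_comp_seed_past hrun.seed_meas hrun.traj_meas
      (F := fun _ hist => visitedMass (rew hist) y) (fun hist => measurable_const) t)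
    (fun t y ω => (hrew _).visitedMass_mem y) hrun.traj_law hT hε

end Runs

/-! ### The lower-order term and the stopping time. -/

lemma one_le_lowerOrderTerm (M : MDP H S A) (c : Triplet H S A → ℝ) (δ : ℝ) (RPi Rlam : ℕ → ℝ) :
    1 ≤ lowerOrderTerm M c δ RPi Rlam :=
  le_iInf₂ fun T hT => by exact_mod_cast hT.1

lemma exists_lowerOrderTerm_eq {M : MDP H S A} {c : Triplet H S A → ℝ} {δ : ℝ}
    {RPi Rlam : ℕ → ℝ} (h : lowerOrderTerm M c δ RPi Rlam ≠ ⊤) :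
    ∃ T₁ : ℕ, lowerOrderTerm M c δ RPi Rlam = T₁ ∧ 1 ≤ T₁ ∧ ∀ T : ℕ, T₁ ≤ T →
      (numPhases c : ℝ≥0∞) * coverageComplexity M (targetIndicator c)
          * ENNReal.ofReal (3 * RPi T + 12 * Rlam T + 24 * Real.log (4 * T / δ)) + 1
        ≤ (T : ℝ≥0∞) / 2 := by
  unfold lowerOrderTerm at h ⊢
  set U := {T : ℕ | 1 ≤ T ∧ ∀ T' : ℕ, T ≤ T' →
      (numPhases c : ℝ≥0∞) * coverageComplexity M (targetIndicator c)
          * ENNReal.ofReal (3 * RPi T' + 12 * Rlam T' + 24 * Real.log (4 * T' / δ)) + 1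
        ≤ (T' : ℝ≥0∞) / 2} with hU
  have hne : U.Nonempty := by
    by_contra h'
    rw [Set.not_nonempty_iff_eq_empty] at h'
    simp [h'] at h
  exact ⟨sInf U, le_antisymm (iInf₂_le _ (Nat.sInf_mem hne))
    (le_iInf₂ fun T hT => by exact_mod_cast Nat.sInf_le hT), Nat.sInf_mem hne⟩

lemma exists_stopsAfter {c : Triplet H S A → ℝ} {y : ℕ → Traj H S A} {T : ℕ} (hT : 1 ≤ T)
    (h : Covered c (past y T)) :
    ∃ τ ≤ T, StopsAfter c y τ ∧ ∀ z, c z ≤ visitCount (past y τ) z := by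
  classical
  have hex : ∃ t, 1 ≤ t ∧ ∀ z, c z ≤ visitCount (past y t) z := ⟨T, hT, h⟩
  exact ⟨Nat.find hex, Nat.find_min' hex ⟨hT, h⟩,
    ⟨Nat.find_spec hex, fun t ht => Nat.find_min' hex ht⟩, (Nat.find_spec hex).2⟩

end ActiveCoverage

end

/-! ### The sample complexity bound. -/

open ActiveCoverage in
theorem mainTheorem2 {H : ℕ} {S : Type v} {A : Type w} [Fintype S] [Fintype A]
    {Ξ : Type x} [MeasurableSpace Ξ]
    (M : ActiveCoverage.MDP H S A)
    (c : ActiveCoverage.Triplet H S A → ℝ)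
    (L : ActiveCoverage.OnlineLearner H S A)
    (P : ActiveCoverage.RLLearner H S A Ξ)
    (Rlam : ℕ → ℝ) (RPi : ℝ → ℕ → ℝ) (δ : ℝ) (hδ0 : 0 < δ) (hδ1 : δ < 1)
    (hreach : ActiveCoverage.Reachable M)
    (hinit : ∀ (h : Fin H) (s : S) (a : A), (h : ℕ) = 0 → s ≠ M.init → c (h, s, a) ≤ 0)
    (hlam : ActiveCoverage.OnlineFirstOrderRegret c L Rlam)
    (hPi : ActiveCoverage.RLFirstOrderRegret.{u, v, w, x} M c P RPi)
    (hT1 : ActiveCoverage.lowerOrderTerm M c δ (RPi (δ / 2)) Rlam ≠ ⊤)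
    {Ω : Type u} [mΩ : MeasurableSpace Ω] (μ : Measure Ω) [IsProbabilityMeasure μ]
    (ℱ : Filtration ℕ mΩ) (ξ : Ω → Ξ) (Y : ℕ → Ω → ActiveCoverage.Traj H S A)
    (hrun : ActiveCoverage.IsRun M P (δ / 2) (ActiveCoverage.covGameReward c L) μ ℱ ξ Y) :
    ENNReal.ofReal (1 - δ) ≤ μ {ω | ∃ τ : ℕ,
      ActiveCoverage.StopsAfter c (fun t => Y t ω) τ ∧
      (∀ z, c z ≤ ActiveCoverage.visitCount (ActiveCoverage.past (fun t => Y t ω) τ) z) ∧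
      (τ : ℝ≥0∞) ≤ 64 * (ActiveCoverage.numPhases c : ℝ≥0∞) * ActiveCoverage.coverageComplexity M c
        + ActiveCoverage.lowerOrderTerm M c δ (RPi (δ / 2)) Rlam} := by
  rcases (targetSet c).eq_empty_or_nonempty with hc | hc
  -- Without positive requirements CovGame stops after its first episode, and 1 ≤ T₁.
  · have huniv : {ω | ∃ τ : ℕ, StopsAfter c (fun t => Y t ω) τ ∧
        (∀ z, c z ≤ visitCount (past (fun t => Y t ω) τ) z) ∧
        (τ : ℝ≥0∞) ≤ 64 * (numPhases c : ℝ≥0∞) * coverageComplexity M c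
          + lowerOrderTerm M c δ (RPi (δ / 2)) Rlam} = Set.univ := by
      refine Set.eq_univ_of_forall fun ω => ?_
      obtain ⟨τ, hτ, h1, h2⟩ := exists_stopsAfter (c := c) (y := fun t => Y t ω) le_rfl
        (covered_iff.2 (by simp [hc]))
      refine ⟨τ, h1, h2, ?_⟩
      calc (τ : ℝ≥0∞) ≤ 1 := by exact_mod_cast hτ
        _ ≤ lowerOrderTerm M c δ (RPi (δ / 2)) Rlam := one_le_lowerOrderTerm ..
        _ ≤ _ := le_add_self
    rw [huniv, measure_univ]
    exact ENNReal.ofReal_le_one.2 (by linarith)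
  have hrew : ∀ hist, IsDistOn (targetSet c) (covGameReward c L hist) := fun hist =>
    (isDistOn_covGameReward hc L hist).mono (levelSet_subset_targetSet c _)
  obtain ⟨hmono, hreg⟩ := hPi (δ / 2) (by linarith) (by linarith)
  have hG1 := hreg _ hrew Ω μ ℱ ξ Y hrun
  set G₁ := {ω | ∀ T : ℕ, 1 ≤ T →
        (∑ t ∈ Finset.range T, optValue M (rewardAt (covGameReward c L) Y t ω))
            - ∑ t ∈ Finset.range T, value M (policyAt P (δ / 2) (covGameReward c L) ξ Y t ω)
                (rewardAt (covGameReward c L) Y t ω)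
          ≤ √(RPi (δ / 2) T * ∑ t ∈ Finset.range T,
                value M (policyAt P (δ / 2) (covGameReward c L) ξ Y t ω)
                  (rewardAt (covGameReward c L) Y t ω)) + RPi (δ / 2) T} with hG1def
  -- The regret event has positive probability, hence contains a point. There the regret is
  -- nonnegative, whereas a negative regret function would make the square root 0 and the bound
  -- negative.
  have hRp0 : ∀ T, 1 ≤ T → 0 ≤ RPi (δ / 2) T := by
    intro T hT
    have hne : G₁.Nonempty := by
      by_contra h
      rw [Set.not_nonempty_iff_eq_empty] at h
      rw [h, measure_empty, nonpos_iff_eq_zero, ENNReal.ofReal_eq_zero] at hG1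
      linarith
    obtain ⟨ω, hω⟩ := hne
    have h := hω T hT
    by_contra hneg
    have hV0 : 0 ≤ ∑ t ∈ Finset.range T,
        value M (policyAt P (δ / 2) (covGameReward c L) ξ Y t ω)
          (rewardAt (covGameReward c L) Y t ω) :=
      Finset.sum_nonneg fun t _ => (hrew _).value_nonneg M _
    rw [Real.sqrt_eq_zero_of_nonpos
      (mul_nonpos_of_nonpos_of_nonneg (not_le.1 hneg).le hV0)] at h
    have h2 := Finset.sum_le_sum fun t (_ : t ∈ Finset.range T) =>
      (hrew (past (fun j => Y j ω) t)).value_le_optValue M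
        (policyAt P (δ / 2) (covGameReward c L) ξ Y t ω)
    simp only [rewardAt] at h
    linarith
  obtain ⟨T₁, hT₁eq, hT₁1, hT₁⟩ := exists_lowerOrderTerm_eq hT1
  have hlog : ∀ T : ℕ, 1 ≤ T → 1 ≤ Real.log (4 * T / δ) := fun T hT => by
    rw [Real.le_log_iff_exp_le (by positivity), le_div_iff₀ hδ0]
    have h1 : (1 : ℝ) ≤ T := by exact_mod_cast hT
    have h2 := Real.exp_one_lt_d9
    have h3 : Real.exp 1 * δ ≤ Real.exp 1 := mul_le_of_le_one_right (Real.exp_pos _).le hδ1.le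
    linarith
  have hm0 : (numPhases c : ℝ≥0∞) ≠ 0 := by
    have : 1 ≤ numPhases c := le_max_right _ _
    exact_mod_cast (by omega : numPhases c ≠ 0)
  -- Finiteness of T₁ forces that of φ⋆(𝟙_𝒳), because the factor multiplying it is positive.
  have hfin : coverageComplexity M (targetIndicator c) ≠ ⊤ := by
    intro htop
    have h := hT₁ T₁ le_rfl
    have hpos : 0 < 3 * RPi (δ / 2) T₁ + 12 * Rlam T₁ + 24 * Real.log (4 * T₁ / δ) := by
      have h1 := hRp0 T₁ hT₁1
      have h2 := hlam.nonneg hc hT₁1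
      have h3 := hlog T₁ hT₁1
      linarith
    rw [htop, ENNReal.mul_top hm0, ENNReal.top_mul (by simpa using hpos), top_add,
      top_le_iff] at h
    exact (ENNReal.div_ne_top (ENNReal.natCast_ne_top _) two_ne_zero) h
  have hcfin := coverageComplexity_ne_top M hc hfin
  set φc := (coverageComplexity M c).toReal with hφc
  set φX := (coverageComplexity M (targetIndicator c)).toReal with hφX
  have hφc0 : 0 ≤ φc := ENNReal.toReal_nonneg
  have hφX0 : 0 ≤ φX := ENNReal.toReal_nonneg
  set B : ℝ := 64 * numPhases c * φc + T₁ with hB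
  have hBnn : 0 ≤ 64 * numPhases c * φc := by positivity
  have hB0 : 0 ≤ B := by positivity
  have hBeq : 64 * (numPhases c : ℝ≥0∞) * coverageComplexity M c
      + lowerOrderTerm M c δ (RPi (δ / 2)) Rlam = ENNReal.ofReal B := by
    rw [hT₁eq, hB, ENNReal.ofReal_add hBnn (by positivity), ENNReal.ofReal_mul (by positivity),
      ENNReal.ofReal_mul (by positivity), hφc, ENNReal.ofReal_toReal hcfin]
    simp
  -- The largest number of episodes that the claimed bound allows; it is deterministic, so the
  -- deviation bound is only needed up to this time.
  set T := ⌊B⌋₊ with hTdef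
  have hTB : (T : ℝ) ≤ B := Nat.floor_le hB0
  have hBT : B < T + 1 := Nat.lt_floor_add_one B
  have hT₁T : T₁ ≤ T := Nat.le_floor (by linarith)
  have hT1' : 1 ≤ T := hT₁1.trans hT₁T
  have hTbound : numPhases c * φX
      * (3 * RPi (δ / 2) T + 12 * Rlam T + 24 * Real.log (4 * T / δ)) + 1 ≤ (T : ℝ) / 2 := by
    have hnn : 0 ≤ 3 * RPi (δ / 2) T + 12 * Rlam T + 24 * Real.log (4 * T / δ) := by
      have h1 := hRp0 T hT1'
      have h2 := hlam.nonneg hc hT1'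
      have h3 := hlog T hT1'
      linarith
    have h := ENNReal.toReal_mono (ENNReal.div_ne_top (ENNReal.natCast_ne_top _) two_ne_zero)
      (hT₁ T hT₁T)
    rw [ENNReal.toReal_add (ENNReal.mul_ne_top (ENNReal.mul_ne_top (ENNReal.natCast_ne_top _) hfin)
      ENNReal.ofReal_ne_top) ENNReal.one_ne_top, ENNReal.toReal_mul, ENNReal.toReal_mul,
      ENNReal.toReal_ofReal hnn, ENNReal.toReal_div] at h
    simpa using h
  have hdev := hrun.measure_value_deviation_le hrew hT1' (half_pos hδ0)
  set G₂ := {ω | ∀ t, 1 ≤ t → t ≤ T →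
        ∑ s ∈ Finset.range t, value M (policyAt P (δ / 2) (covGameReward c L) ξ Y s ω)
            (rewardAt (covGameReward c L) Y s ω)
          ≤ 2 * ∑ s ∈ Finset.range t, visitedMass (rewardAt (covGameReward c L) Y s ω) (Y s ω)
            + 2 * Real.log (T / (δ / 2))} with hG2def
  have hgood : ∀ ω ∈ G₁ ∩ G₂, Covered c (past (fun t => Y t ω) T) := by
    rintro ω ⟨h1, h2⟩
    by_contra hnot
    have hV : ∀ t, 0 ≤ value M (policyAt P (δ / 2) (covGameReward c L) ξ Y t ω)
        (rewardAt (covGameReward c L) Y t ω) := fun t => (hrew _).value_nonneg M _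
    have hℓ1 : Real.log (T / (δ / 2)) ≤ Real.log (4 * T / δ) := by
      have hT0 : (0 : ℝ) < T := by exact_mod_cast hT1'
      refine Real.log_le_log (by positivity) ?_
      rw [div_div_eq_mul_div]
      gcongr ?_ / δ
      linarith
    have hℓ0 : 0 ≤ Real.log (T / (δ / 2)) := Real.log_nonneg (by
      rw [le_div_iff₀ (by positivity)]
      have : (1 : ℝ) ≤ T := by exact_mod_cast hT1'
      linarith)
    have hle := episodes_le_of_not_covered M hlam hc hfin hT1' hnot hV (hRp0 T hT1') hℓ0
      (fun t ht htT => by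
        have h3 := h1 t ht
        have h4 : RPi (δ / 2) t ≤ RPi (δ / 2) T := hmono ht hT1' htT
        refine h3.trans (add_le_add (Real.sqrt_le_sqrt ?_) h4)
        exact mul_le_mul_of_nonneg_right h4 (Finset.sum_nonneg fun s _ => hV s))
      h2
    have hR := hlam.nonneg hc hT1'
    have hRp := hRp0 T hT1'
    have hl := hlog T hT1'
    have hm1 : (1 : ℝ) ≤ numPhases c := by exact_mod_cast (le_max_right _ _ : 1 ≤ numPhases c)
    have hT₁1' : (1 : ℝ) ≤ T₁ := by exact_mod_cast hT₁1
    have h5 : φX * (3 * Real.log (T / (δ / 2)) + 3 / 2 * RPi (δ / 2) T)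
        ≤ numPhases c * φX * (3 * Real.log (4 * T / δ) + 3 / 2 * RPi (δ / 2) T) :=
      mul_le_mul (le_mul_of_one_le_left hφX0 hm1) (by linarith) (by positivity) (by positivity)
    -- The constant 18 is absorbed by the logarithm, which is at least 1 by `hlog`.
    have h6 : numPhases c * φX * (18 + 9 * Rlam T + 3 * Real.log (4 * T / δ)
          + 3 / 2 * RPi (δ / 2) T)
        ≤ numPhases c * φX
          * (3 * RPi (δ / 2) T + 12 * Rlam T + 24 * Real.log (4 * T / δ)) :=
      mul_le_mul_of_nonneg_left (by linarith) (by positivity)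
    -- Altogether T ≤ 12 m φ⋆(c) + T/2 - 1, that is T ≤ 24 m φ⋆(c) - 2, against T > 64 m φ⋆(c) + T₁
    -- - 1.
    linarith
  have hsub : G₁ ∩ G₂ ⊆ {ω | ∃ τ : ℕ, StopsAfter c (fun t => Y t ω) τ ∧
        (∀ z, c z ≤ visitCount (past (fun t => Y t ω) τ) z) ∧
        (τ : ℝ≥0∞) ≤ 64 * (numPhases c : ℝ≥0∞) * coverageComplexity M c
          + lowerOrderTerm M c δ (RPi (δ / 2)) Rlam} := by
    intro ω hω
    obtain ⟨τ, hτ, h1, h2⟩ := exists_stopsAfter hT1' (hgood ω hω)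
    refine ⟨τ, h1, h2, ?_⟩
    rw [hBeq, ← ENNReal.ofReal_natCast]
    exact ENNReal.ofReal_le_ofReal (le_trans (by exact_mod_cast hτ) hTB)
  calc ENNReal.ofReal (1 - δ) = ENNReal.ofReal (1 - δ / 2) - ENNReal.ofReal (δ / 2) := by
        rw [← ENNReal.ofReal_sub _ (by positivity)]
        congr 1
        ring
    _ ≤ μ (G₁ ∩ G₂) := by
        rw [tsub_le_iff_right]
        calc _ ≤ μ G₁ := hG1
          _ ≤ μ (G₁ ∩ G₂ ∪ G₂ᶜ) := measure_mono fun ω hω => by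
              by_cases h : ω ∈ G₂
              · exact Or.inl ⟨hω, h⟩
              · exact Or.inr h
          _ ≤ μ (G₁ ∩ G₂) + μ G₂ᶜ := measure_union_le _ _
          _ ≤ _ := by gcongr
    _ ≤ _ := measure_mono hsub
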